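/- A permutation $\pi\in S_n$ contains a pattern $\sigma\in S_m$ if there are indices $i_1<\dots<i_m$ such that $\pi_{i_1}\cdots\pi_{i_m}$ is in the same relative order as $\sigma_1\cdots\sigma_m$; otherwise it avoids $\sigma$. For a set $\Sigma$ of patterns let $S_n(\Sigma)$ be the set of permutations in $S_n$ that avoid every element of $\Sigma$. For $\pi\in S_n$ let $\mathrm{fp}(\pi)$ be the number of $i$ with $\pi_i=i$ and $\mathrm{exc}(\pi)$ the number of $i$ with $\pi_i>i$. Define the formal power series $$F_\Sigma(x,q,z)=\sum_{n\ge 0}\ \sum_{\pi\in S_n(\Sigma)}x^{\mathrm{fp}(\pi)}q^{\mathrm{exc}(\pi)}z^n\in\mathbb{Z}[x,q][[z]].$$ **Theorem.** The generating functions $F_\Sigma$ for the sets $\Sigma$ of three patterns of length 3 are as follows. **a)** $$F_{\{123,132,213\}}(x,q,z)=\frac{1 + xz + (x^2 - q)z^2 + (-xq + q^2 + q)z^3 - x^2qz^4}{(1 + qz^2)(1 - 3qz^2 + q^2z^4)}$$ **b)** $$F_{\{231,312,321\}}(x,q,z)=\frac{1}{1 - xz - qz^2}$$ **c)** $$F_{\{123,132,231\}}(x,q,z)=F_{\{123,213,231\}}(x,q,z)=\frac{1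 + xz + (x^2 - q)z^2 + qz^3 + (-x^2q + xq + q^2)z^4}{(1 - qz^2)^2}$$ **c')** $$F_{\{123,132,312\}}(x,q,z)=F_{\{123,213,312\}}(x,q,z)=\frac{1 + xz + (x^2 - q)z^2 + q^2z^3 + (-x^2q + xq^2 + q^2)z^4}{(1 - qz^2)^2}$$ **d)** $$F_{\{132,231,321\}}(x,q,z)=F_{\{213,231,321\}}(x,q,z)=\frac{1 - z + qz^2}{(1 - z)(1 - xz)}$$ **d')** $$F_{\{132,312,321\}}(x,q,z)=F_{\{213,312,321\}}(x,q,z)=\frac{1 - qz + qz^2}{(1 - xz)(1 - qz)}$$ **e)** $$F_{\{132,213,231\}}(x,q,z)=\frac{1 - z - qz^2 + 2qz^3 + (-x^2q + q^2 - xq)z^4 + (x^2q - 2q^2)z^5 + xq^2z^6}{(1 - z)(1 - xz)(1 - qz^2)^2}$$ **e')** $$F_{\{132,213,312\}}(x,q,z)=\frac{1 - qz - qz^2 + 2q^2z^3 + (-x^2q - xq^2 + q^2)z^4 + (x^2q^2 - 2q^3)z^5 + xq^3z^6}{(1 - xz)(1 - qz)(1 - qz^2)^2}$$ **f)** $$F_{\{132,231,312\}}(x,q,z)=F_{\{213,231,312\}}(x,q,z)=\frac{1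 + xqz^3}{(1 - xz)(1 - qz^2)}$$ **g)** $$F_{\{123,231,312\}}(x,q,z)=\frac{1 + xz + (x^2 - q)z^2 + xqz^3 + q^2z^4}{(1 - qz^2)^2}$$ **h)** $$F_{\{132,213,321\}}(x,q,z)=\frac{1 - (1 + q)z + 2qz^2 - xqz^3}{(1 - z)(1 - xz)(1 - qz)}$$ **i)** $$F_{\{123,132,321\}}(x,q,z)=F_{\{123,213,321\}}(x,q,z)=1 + xz + (x^2 + q)z^2 + (xq + q^2 + q)z^3 + q^2z^4$$ **j)** $$F_{\{123,231,321\}}(x,q,z)=1 + xz + (x^2 + q)z^2 + (2xq + q)z^3 + q^2z^4$$ **j')** $$F_{\{123,312,321\}}(x,q,z)=1 + xz + (x^2 + q)z^2 + (2xq + q^2)z^3 + q^2z^4$$ The twenty sets listed above are all the three-element subsets of $S_3$. -/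

import Mathlib

open scoped PowerSeries

namespace PatternAvoidance

/-- A pattern: a permutation of some finite length `k`. -/
abbrev Pattern : Type := Σ k : ℕ, Equiv.Perm (Fin k)

/-- `π` contains `σ`: there are indices `i₁ < ⋯ < iₘ` (the values of `f`) such that
`π i₁, …, π iₘ` is in the same relative order as `σ 1, …, σ m`. -/
def Contains {n m : ℕ} (π : Equiv.Perm (Fin n)) (σ : Equiv.Perm (Fin m)) : Prop :=
  ∃ f : Fin m → Fin n, StrictMono f ∧ ∀ i j : Fin m, π (f i) < π (f j) ↔ σ i < σ j

/-- `π` avoids every pattern in `S`. -/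
def Avoids {n : ℕ} (π : Equiv.Perm (Fin n)) (S : Set Pattern) : Prop :=
  ∀ p ∈ S, ¬ Contains π p.2

/-- The number of fixed points. -/
def fp {n : ℕ} (π : Equiv.Perm (Fin n)) : ℕ :=
  (Finset.univ.filter fun i : Fin n => π i = i).card

/-- The number of excedances. -/
def exc {n : ℕ} (π : Equiv.Perm (Fin n)) : ℕ :=
  (Finset.univ.filter fun i : Fin n => i < π i).card

/-- `ℤ[x, q]`, where `x` and `q` are the variables with index `0` and `1`. -/
abbrev Coeffs : Type := MvPolynomial (Fin 2) ℤ

open Classical in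
/-- `F_S(x, q, z) = ∑ₙ ∑_π x ^ fp π * q ^ exc π * z ^ n`, where `π` runs over the permutations of
length `n` that avoid `S`, as a formal power series in `z` over `ℤ[x, q]`. -/
noncomputable def F (S : Set Pattern) : Coeffs⟦X⟧ :=
  PowerSeries.mk fun n : ℕ =>
    ∑ π : Equiv.Perm (Fin n) with Avoids π S,
      (MvPolynomial.X 0 : Coeffs) ^ fp π * (MvPolynomial.X 1 : Coeffs) ^ exc π

/-- The variable `x` as a power series. -/
noncomputable def varX : Coeffs⟦X⟧ := PowerSeries.C (MvPolynomial.X 0 : Coeffs)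

/-- The variable `q` as a power series. -/
noncomputable def varQ : Coeffs⟦X⟧ := PowerSeries.C (MvPolynomial.X 1 : Coeffs)

/-- The variable `z` as a power series. -/
noncomputable def varZ : Coeffs⟦X⟧ := PowerSeries.X

/-- The fraction `a / b` of power series, for an invertible denominator `b`. -/
noncomputable def frac (a b : Coeffs⟦X⟧) : Coeffs⟦X⟧ := a * Ring.inverse b

/-- The pattern `123` in one-line notation. -/
def p123 : Pattern :=
  ⟨3, ⟨![0, 1, 2], ![0, 1, 2], by decide, by decide⟩⟩

/-- The pattern `132` in one-line notation. -/
def p132 : Pattern :=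
  ⟨3, ⟨![0, 2, 1], ![0, 2, 1], by decide, by decide⟩⟩

/-- The pattern `213` in one-line notation. -/
def p213 : Pattern :=
  ⟨3, ⟨![1, 0, 2], ![1, 0, 2], by decide, by decide⟩⟩

/-- The pattern `231` in one-line notation. -/
def p231 : Pattern :=
  ⟨3, ⟨![1, 2, 0], ![2, 0, 1], by decide, by decide⟩⟩

/-- The pattern `312` in one-line notation. -/
def p312 : Pattern :=
  ⟨3, ⟨![2, 0, 1], ![1, 2, 0], by decide, by decide⟩⟩

/-- The pattern `321` in one-line notation. -/
def p321 : Pattern :=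
  ⟨3, ⟨![2, 1, 0], ![2, 1, 0], by decide, by decide⟩⟩

end PatternAvoidance

open PatternAvoidance

/-! Besides fixed points (`x`) and excedances (`q`), anti-excedances are recorded by a third
variable `r`, so that a permutation has weight the product of `entryWeight x q r i (π i)`. Inversion
and reverse-complement both exchange `q` and `r` in `genFun`, and their composite leaves it
unchanged. Hence ten sets suffice: every other set is an image of one of them, and its series comes
from `r = 1`, or from `q = 1` with `r` in the role of `q` (the primed cases).

Six of the ten sets have exactly `n` avoiders of each length `n > 0`, one for each value of a
parameter `k < n`: the first entry, the number of earlier entries above the last one, or the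
position of the smallest entry. `weightSum_eq_sum_family` turns the weighted sum into a sum over
`k`. Each term is a product of powers of `x`, `q`, `r` and of weights of decreasing permutations, so
that `genFun` becomes a combination of geometric series, the series `decSeries`, and series
satisfying simple recurrences.

The avoiders of `231`, `312`, `321` are the layered permutations with blocks `1` and `21`. Splitting
off the first block gives a two-term recurrence (`weightSum_231_312_321_add_two`), valid for
arbitrary entry weights. Complementing values sends the avoiders of `123`, `132`, `213` to the same
permutations, with weights that depend only on the antidiagonal. Cutting at the middle then gives
closed forms with products of Fibonacci numbers (`weightSum_123_132_213_odd`,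
`weightSum_123_132_213_even`), whose recurrence explains the denominator of (a).

A set containing both `123` and `321` has no avoiders of length at least five, so the two remaining
sets reduce to a finite computation. -/

namespace PatternAvoidance

/-! ### Inversion and reverse-complement on permutations and patterns. -/

section Symmetry

/-- The inverse of a pattern. -/
def Pattern.inv (p : Pattern) : Pattern := ⟨p.1, p.2⁻¹⟩

/-- The reverse-complement of a permutation. -/
def revComp {n : ℕ} (π : Equiv.Perm (Fin n)) : Equiv.Perm (Fin n) :=
  Fin.revPerm * π * Fin.revPerm

/-- The reverse-complement of a pattern. -/
def Pattern.revComp (p : Pattern) : Pattern := ⟨p.1, PatternAvoidance.revComp p.2⟩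

@[simp] lemma revComp_apply {n : ℕ} (π : Equiv.Perm (Fin n)) (i : Fin n) :
    revComp π i = (π i.rev).rev := rfl

lemma revComp_revComp {n : ℕ} (π : Equiv.Perm (Fin n)) : revComp (revComp π) = π := by
  ext i; simp

lemma Contains.inv {n m : ℕ} {π : Equiv.Perm (Fin n)} {σ : Equiv.Perm (Fin m)}
    (h : Contains π σ) : Contains π⁻¹ σ⁻¹ := by
  obtain ⟨f, hf, h⟩ := h
  -- The positions of the occurrence in `π⁻¹` are the values of the old occurrence; precomposing
  -- with `σ⁻¹` lists them in increasing order.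
  refine ⟨fun i => π (f (σ⁻¹ i)), fun i j hij => ?_, fun i j => ?_⟩
  · rw [h]; simpa using hij
  · simpa using hf.lt_iff_lt

lemma Contains.revComp {n m : ℕ} {π : Equiv.Perm (Fin n)} {σ : Equiv.Perm (Fin m)}
    (h : Contains π σ) : Contains (revComp π) (revComp σ) := by
  obtain ⟨f, hf, h⟩ := h
  refine ⟨fun i => (f i.rev).rev, fun i j hij => ?_, fun i j => ?_⟩
  · simpa using hf (Fin.rev_lt_rev.2 hij)
  · simpa using h j.rev i.rev

lemma avoids_inv_image {n : ℕ} {π : Equiv.Perm (Fin n)} {S : Set Pattern} :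
    Avoids π⁻¹ (Pattern.inv '' S) ↔ Avoids π S := by
  constructor
  · intro h p hp hc
    exact h _ (Set.mem_image_of_mem _ hp) hc.inv
  · rintro h _ ⟨p, hp, rfl⟩ hc
    have := hc.inv
    rw [Pattern.inv, inv_inv, inv_inv] at this
    exact h p hp this

lemma avoids_revComp_image {n : ℕ} {π : Equiv.Perm (Fin n)} {S : Set Pattern} :
    Avoids (revComp π) (Pattern.revComp '' S) ↔ Avoids π S := by
  constructor
  · intro h p hp hc
    exact h _ (Set.mem_image_of_mem _ hp) hc.revComp
  · rintro h _ ⟨p, hp, rfl⟩ hc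
    refine h p hp ?_
    have := hc.revComp
    rwa [revComp_revComp, Pattern.revComp, revComp_revComp] at this

lemma perm_ext_three {σ τ : Equiv.Perm (Fin 3)} (h0 : σ 0 = τ 0) (h1 : σ 1 = τ 1)
    (h2 : σ 2 = τ 2) : σ = τ := by
  refine Equiv.ext fun i => ?_
  fin_cases i
  exacts [h0, h1, h2]

lemma inv_p123 : p123.inv = p123 := congrArg (Sigma.mk 3) (perm_ext_three rfl rfl rfl)
lemma inv_p132 : p132.inv = p132 := congrArg (Sigma.mk 3) (perm_ext_three rfl rfl rfl)
lemma inv_p213 : p213.inv = p213 := congrArg (Sigma.mk 3) (perm_ext_three rfl rfl rfl)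
lemma inv_p231 : p231.inv = p312 := congrArg (Sigma.mk 3) (perm_ext_three rfl rfl rfl)
lemma inv_p312 : p312.inv = p231 := congrArg (Sigma.mk 3) (perm_ext_three rfl rfl rfl)
lemma inv_p321 : p321.inv = p321 := congrArg (Sigma.mk 3) (perm_ext_three rfl rfl rfl)
lemma revComp_p123 : p123.revComp = p123 := congrArg (Sigma.mk 3) (perm_ext_three rfl rfl rfl)
lemma revComp_p132 : p132.revComp = p213 := congrArg (Sigma.mk 3) (perm_ext_three rfl rfl rfl)
lemma revComp_p231 : p231.revComp = p312 := congrArg (Sigma.mk 3) (perm_ext_three rfl rfl rfl)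
lemma revComp_p312 : p312.revComp = p231 := congrArg (Sigma.mk 3) (perm_ext_three rfl rfl rfl)
lemma revComp_p321 : p321.revComp = p321 := congrArg (Sigma.mk 3) (perm_ext_three rfl rfl rfl)

end Symmetry

/-! ### Weighted sums, and the exchange of excedances and anti-excedances. -/

section Weights

variable {A : Type*}

/-- The weight of the entry `j` at position `i`: `x` for a fixed point, `q` for an excedance, and
`r` for an anti-excedance. -/
def entryWeight (x q r : A) (i j : ℕ) : A := if j = i then x else if i < j then q else r

lemma entryWeight_self (x q r : A) (i : ℕ) : entryWeight x q r i i = x := by simp [entryWeight]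

lemma entryWeight_of_lt (x q r : A) {i j : ℕ} (h : i < j) : entryWeight x q r i j = q := by
  simp [entryWeight, h, h.ne']

lemma entryWeight_of_gt (x q r : A) {i j : ℕ} (h : j < i) : entryWeight x q r i j = r := by
  simp [entryWeight, h.ne, h.not_gt]

variable [CommRing A]

open Classical in
/-- The sum over all permutations `π` of length `n` avoiding `S` of the products of the
weights `w i (π i)`. -/
noncomputable def weightSum (S : Set Pattern) (n : ℕ) (w : ℕ → ℕ → A) : A :=
  ∑ π : Equiv.Perm (Fin n) with Avoids π S, ∏ i : Fin n, w i (π i)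

lemma prod_entryWeight (x q r : A) {n : ℕ} (π : Equiv.Perm (Fin n)) :
    ∏ i : Fin n, entryWeight x q r i (π i) =
      x ^ fp π * q ^ exc π * r ^ (Finset.univ.filter fun i : Fin n => π i < i).card := by
  simp only [fp, exc, Finset.card_filter, ← Finset.prod_pow_eq_pow_sum, ← Finset.prod_mul_distrib]
  refine Finset.prod_congr rfl fun i _ => ?_
  rcases lt_trichotomy (π i) i with h | h | h
  · simp [entryWeight, h, h.ne, h.not_gt, Fin.val_ne_of_ne]
  · simp [entryWeight, h]
  · simp [entryWeight, h, h.ne', h.not_gt, Fin.val_ne_of_ne]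

/-- The generating function of the permutations avoiding `S` by fixed points, excedances and
anti-excedances. -/
noncomputable def genFun (S : Set Pattern) (x q r : A) : A⟦X⟧ :=
  PowerSeries.mk fun n => weightSum S n (entryWeight x q r)

/-- Inversion reflects each point `(i, π i)` in the diagonal, so fixed points stay fixed points
while excedances and anti-excedances change places. -/
lemma weightSum_inv (S : Set Pattern) (n : ℕ) (x q r : A) :
    weightSum (Pattern.inv '' S) n (entryWeight x q r) = weightSum S n (entryWeight x r q) := by
  classical
  unfold weightSum
  symm
  refine Finset.sum_nbij' (fun π => π⁻¹) (fun π => π⁻¹) ?_ ?_ ?_ ?_ ?_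
  · intro π h
    simpa [avoids_inv_image] using h
  · intro π h
    have := (Finset.mem_filter.1 h).2
    rw [← inv_inv π, avoids_inv_image] at this
    simpa using this
  · simp
  · simp
  · intro π _
    rw [← Equiv.prod_comp π fun i : Fin n => entryWeight x q r i (π⁻¹ i)]
    refine Finset.prod_congr rfl fun i _ => ?_
    rcases lt_trichotomy (π i) i with h | h | h
    · simp [entryWeight, h, h.ne, h.ne', h.not_gt, Fin.val_ne_of_ne]
    · simp [entryWeight, Equiv.Perm.inv_eq_iff_eq.2 h.symm, h]
    · simp [entryWeight, h, h.ne, h.ne', h.not_gt, Fin.val_ne_of_ne]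

/-- Reverse-complement rotates the diagram by a half turn, which also preserves the diagonal and
interchanges its two sides. -/
lemma weightSum_revComp (S : Set Pattern) (n : ℕ) (x q r : A) :
    weightSum (Pattern.revComp '' S) n (entryWeight x q r) =
      weightSum S n (entryWeight x r q) := by
  classical
  unfold weightSum
  symm
  refine Finset.sum_nbij' revComp revComp ?_ ?_ ?_ ?_ ?_
  · intro π h
    simpa [avoids_revComp_image] using h
  · intro π h
    have := (Finset.mem_filter.1 h).2
    rw [← revComp_revComp π, avoids_revComp_image] at this
    simpa using this
  · intro π _
    exact revComp_revComp π
  · intro π _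
    exact revComp_revComp π
  · intro π _
    rw [← Equiv.prod_comp Fin.revPerm fun i : Fin n => entryWeight x q r i (revComp π i)]
    refine Finset.prod_congr rfl fun i _ => ?_
    have hi := i.isLt
    have hp := (π i).isLt
    simp only [Fin.revPerm_apply, revComp_apply, Fin.rev_rev, entryWeight, Fin.val_rev]
    split_ifs <;> first | rfl | omega

lemma genFun_inv (S : Set Pattern) (x q r : A) :
    genFun (Pattern.inv '' S) x q r = genFun S x r q := by
  simp [genFun, weightSum_inv]

lemma genFun_revComp (S : Set Pattern) (x q r : A) :
    genFun (Pattern.revComp '' S) x q r = genFun S x r q := by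
  simp [genFun, weightSum_revComp]

lemma F_eq_genFun (S : Set Pattern) :
    F S = genFun S (MvPolynomial.X 0 : Coeffs) (MvPolynomial.X 1) 1 := by
  ext1 n
  simp [F, genFun, weightSum, prod_entryWeight]

end Weights

/-! ### Patterns of length three as conditions on triples of values. -/

section Triples

lemma contains_three_iff {n : ℕ} (π : Equiv.Perm (Fin n)) (σ : Equiv.Perm (Fin 3)) :
    Contains π σ ↔ ∃ a b c : Fin n, a < b ∧ b < c ∧ (π a < π b ↔ σ 0 < σ 1) ∧
      (π a < π c ↔ σ 0 < σ 2) ∧ (π b < π c ↔ σ 1 < σ 2) := by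
  constructor
  · rintro ⟨f, hf, hr⟩
    exact ⟨_, _, _, hf (show (0 : Fin 3) < 1 by decide), hf (show (1 : Fin 3) < 2 by decide),
      hr 0 1, hr 0 2, hr 1 2⟩
  · rintro ⟨a, b, c, hab, hbc, h1, h2, h3⟩
    -- Values are distinct, so each of the three given comparisons determines its reverse; together
    -- with the trivial diagonal cases this covers all nine pairs.
    have swap : ∀ {i j : Fin n} {k l : Fin 3}, i ≠ j → k ≠ l → (π i < π j ↔ σ k < σ l) →
        (π j < π i ↔ σ l < σ k) := by
      intro i j k l hij hkl h
      have h1 : π i ≠ π j := π.injective.ne hij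
      have h2 : σ k ≠ σ l := σ.injective.ne hkl
      constructor
      · intro h3
        exact lt_of_le_of_ne (not_lt.1 fun h4 => h3.not_gt (h.2 h4)) h2.symm
      · intro h3
        exact lt_of_le_of_ne (not_lt.1 fun h4 => h3.not_gt (h.1 h4)) h1.symm
    refine ⟨![a, b, c], ?_, ?_⟩
    · refine Fin.strictMono_iff_lt_succ.2 fun i => ?_
      fin_cases i
      exacts [hab, hbc]
    · intro i j
      fin_cases i <;> fin_cases j
      exacts [by simp, h1, h2, swap hab.ne (by decide) h1, by simp, h3,
        swap (hab.trans hbc).ne (by decide) h2, swap hbc.ne (by decide) h3, by simp]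

/-- `P`, `Q`, `R` stand for the truth values of the comparisons in `σ`. The distinctness premises
hold automatically; they are included so that linear arithmetic can contract the three equivalences
to a chain of two inequalities. -/
lemma not_contains_three_iff {n : ℕ} (π : Equiv.Perm (Fin n)) (σ : Equiv.Perm (Fin 3))
    {P Q R : Prop} (hP : σ 0 < σ 1 ↔ P) (hQ : σ 0 < σ 2 ↔ Q) (hR : σ 1 < σ 2 ↔ R) :
    ¬ Contains π σ ↔ ∀ a b c : Fin n, a < b → b < c →
      (π a : ℕ) ≠ π b → (π a : ℕ) ≠ π c → (π b : ℕ) ≠ π c →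
      ¬ (((π a : ℕ) < π b ↔ P) ∧ ((π a : ℕ) < π c ↔ Q) ∧ ((π b : ℕ) < π c ↔ R)) := by
  have ne : ∀ {i j : Fin n}, i < j → (π i : ℕ) ≠ π j := fun h =>
    Fin.val_ne_of_ne (π.injective.ne h.ne)
  simp only [contains_three_iff, hP, hQ, hR, not_exists, Fin.lt_def]
  constructor
  · intro h a b c hab hbc _ _ _ hh
    exact h a b c ⟨hab, hbc, hh⟩
  · rintro h a b c ⟨hab, hbc, hh⟩
    exact h a b c hab hbc (ne hab) (ne (hab.trans hbc)) (ne hbc) hh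

lemma not_contains_p123 {n : ℕ} (π : Equiv.Perm (Fin n)) : ¬ Contains π p123.2 ↔
    ∀ a b c : Fin n, a < b → b < c → ¬ ((π a : ℕ) < π b ∧ (π b : ℕ) < π c) :=
  (not_contains_three_iff π p123.2 (iff_true_intro (show (0 : Fin 3) < 1 by decide))
    (iff_true_intro (show (0 : Fin 3) < 2 by decide))
    (iff_true_intro (show (1 : Fin 3) < 2 by decide))).trans
    (forall₃_congr fun a b c => forall₂_congr fun _ _ => by
      simp only [iff_true]; omega)

lemma not_contains_p132 {n : ℕ} (π : Equiv.Perm (Fin n)) : ¬ Contains π p132.2 ↔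
    ∀ a b c : Fin n, a < b → b < c → ¬ ((π a : ℕ) < π c ∧ (π c : ℕ) < π b) :=
  (not_contains_three_iff π p132.2 (iff_true_intro (show (0 : Fin 3) < 2 by decide))
    (iff_true_intro (show (0 : Fin 3) < 1 by decide))
    (iff_false_intro (show ¬ (2 : Fin 3) < 1 by decide))).trans
    (forall₃_congr fun a b c => forall₂_congr fun _ _ => by
      simp only [iff_true, iff_false]; omega)

lemma not_contains_p213 {n : ℕ} (π : Equiv.Perm (Fin n)) : ¬ Contains π p213.2 ↔
    ∀ a b c : Fin n, a < b → b < c → ¬ ((π b : ℕ) < π a ∧ (π a : ℕ) < π c) :=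
  (not_contains_three_iff π p213.2 (iff_false_intro (show ¬ (1 : Fin 3) < 0 by decide))
    (iff_true_intro (show (1 : Fin 3) < 2 by decide))
    (iff_true_intro (show (0 : Fin 3) < 2 by decide))).trans
    (forall₃_congr fun a b c => forall₂_congr fun _ _ => by
      simp only [iff_true, iff_false]; omega)

lemma not_contains_p231 {n : ℕ} (π : Equiv.Perm (Fin n)) : ¬ Contains π p231.2 ↔
    ∀ a b c : Fin n, a < b → b < c → ¬ ((π c : ℕ) < π a ∧ (π a : ℕ) < π b) :=
  (not_contains_three_iff π p231.2 (iff_true_intro (show (1 : Fin 3) < 2 by decide))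
    (iff_false_intro (show ¬ (1 : Fin 3) < 0 by decide))
    (iff_false_intro (show ¬ (2 : Fin 3) < 0 by decide))).trans
    (forall₃_congr fun a b c => forall₂_congr fun _ _ => by
      simp only [iff_true, iff_false]; omega)

lemma not_contains_p312 {n : ℕ} (π : Equiv.Perm (Fin n)) : ¬ Contains π p312.2 ↔
    ∀ a b c : Fin n, a < b → b < c → ¬ ((π b : ℕ) < π c ∧ (π c : ℕ) < π a) :=
  (not_contains_three_iff π p312.2 (iff_false_intro (show ¬ (2 : Fin 3) < 0 by decide))
    (iff_false_intro (show ¬ (2 : Fin 3) < 1 by decide))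
    (iff_true_intro (show (0 : Fin 3) < 1 by decide))).trans
    (forall₃_congr fun a b c => forall₂_congr fun _ _ => by
      simp only [iff_true, iff_false]; omega)

lemma not_contains_p321 {n : ℕ} (π : Equiv.Perm (Fin n)) : ¬ Contains π p321.2 ↔
    ∀ a b c : Fin n, a < b → b < c → ¬ ((π c : ℕ) < π b ∧ (π b : ℕ) < π a) :=
  (not_contains_three_iff π p321.2 (iff_false_intro (show ¬ (2 : Fin 3) < 1 by decide))
    (iff_false_intro (show ¬ (2 : Fin 3) < 0 by decide))
    (iff_false_intro (show ¬ (1 : Fin 3) < 0 by decide))).trans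
    (forall₃_congr fun a b c => forall₂_congr fun _ _ => by
      simp only [iff_false]; omega)

lemma avoids_triple {n : ℕ} (π : Equiv.Perm (Fin n)) (p₁ p₂ p₃ : Pattern) :
    Avoids π {p₁, p₂, p₃} ↔
      ¬ Contains π p₁.2 ∧ ¬ Contains π p₂.2 ∧ ¬ Contains π p₃.2 := by
  simp [Avoids]

end Triples
-- Listing an avoidance class by a one-parameter family.
section Families

/-- `f` maps `{0, …, n - 1}` injectively to itself, and no three of its values in order of
position satisfy `B`. -/
structure IsAvoider (B : ℕ → ℕ → ℕ → Prop) (n : ℕ) (f : ℕ → ℕ) : Prop where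
  lt : ∀ i < n, f i < n
  ne : ∀ i j, i < j → j < n → f i ≠ f j
  avoids : ∀ a b c, a < b → b < c → c < n → ¬ B (f a) (f b) (f c)

/-- The permutation of `Fin n` given by a function that is injective on `{0, …, n - 1}`. -/
noncomputable def IsAvoider.perm {B : ℕ → ℕ → ℕ → Prop} {n : ℕ} {f : ℕ → ℕ}
    (h : IsAvoider B n f) : Equiv.Perm (Fin n) :=
  Equiv.ofBijective (fun i : Fin n => (⟨f i, h.lt i i.isLt⟩ : Fin n)) <| by
    refine Finite.injective_iff_bijective.1 fun i j hij => ?_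
    have hij : f i = f j := congrArg Fin.val hij
    rcases lt_trichotomy i j with h1 | h1 | h1
    · exact (h.ne i j h1 j.isLt hij).elim
    · exact h1
    · exact (h.ne j i h1 i.isLt hij.symm).elim

@[simp] lemma IsAvoider.val_perm {B : ℕ → ℕ → ℕ → Prop} {n : ℕ} {f : ℕ → ℕ}
    (h : IsAvoider B n f) (i : Fin n) : (h.perm i : ℕ) = f i := rfl

/-- The values of a permutation as a function on the natural numbers. -/
def valFun {n : ℕ} (π : Equiv.Perm (Fin n)) (i : ℕ) : ℕ :=
  if h : i < n then π ⟨i, h⟩ else 0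

@[simp] lemma valFun_val {n : ℕ} (π : Equiv.Perm (Fin n)) (i : Fin n) :
    valFun π i = π i := by
  simp [valFun]

lemma valFun_surj {n : ℕ} (π : Equiv.Perm (Fin n)) {m : ℕ} (hm : m < n) :
    ∃ i < n, valFun π i = m :=
  ⟨π⁻¹ ⟨m, hm⟩, Fin.isLt _, by simp⟩

/-- The permutations of length `n` avoiding `S` are those avoiding `B` at all triples. -/
def AvoidsIff (S : Set Pattern) (B : ℕ → ℕ → ℕ → Prop) : Prop :=
  ∀ (n : ℕ) (π : Equiv.Perm (Fin n)), Avoids π S ↔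
    ∀ a b c : Fin n, a < b → b < c → ¬ B (π a) (π b) (π c)

lemma isAvoider_valFun {S : Set Pattern} {B : ℕ → ℕ → ℕ → Prop} (hS : AvoidsIff S B) {n : ℕ}
    {π : Equiv.Perm (Fin n)} (h : Avoids π S) : IsAvoider B n (valFun π) where
  lt i hi := by simp [valFun, hi]
  ne i j hij hj := by
    simp only [valFun, hij.trans hj, hj, dif_pos, ne_eq, Fin.val_inj, EmbeddingLike.apply_eq_iff_eq,
      Fin.mk.injEq]
    exact hij.ne
  avoids a b c hab hbc hc := by
    simpa [valFun, hab.trans (hbc.trans hc), hbc.trans hc, hc] using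
      (hS n π).1 h ⟨a, by omega⟩ ⟨b, by omega⟩ ⟨c, hc⟩ hab hbc

/-- Two permutations with the same relative order are equal. -/
lemma perm_eq_of_lt_imp_lt {n : ℕ} {π τ : Equiv.Perm (Fin n)}
    (h : ∀ i j, π i < π j → τ i < τ j) : π = τ := by
  have hm : StrictMono (τ * π⁻¹) := fun i j hij => by
    simpa using h (π⁻¹ i) (π⁻¹ j) (by simpa using hij)
  have h1 : ∀ i, (τ * π⁻¹) i = i := by
    -- `τ * π⁻¹` is an order automorphism of a finite chain, and the identity is the only one.
    have := Subsingleton.elim (hm.orderIsoOfSurjective _ (τ * π⁻¹).surjective) (OrderIso.refl _)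
    exact fun i => DFunLike.congr_fun this i
  ext i
  simpa using congrArg Fin.val (h1 (π i)).symm

open Classical in
/-- The weighted sum over the permutations of length `n` that avoid `S`, if these are listed
without repetition by a family of functions. -/
lemma weightSum_eq_sum_family {A : Type*} [CommRing A] {S : Set Pattern}
    {B : ℕ → ℕ → ℕ → Prop} (hS : AvoidsIff S B) {n : ℕ} {f : ℕ → ℕ → ℕ} (w : ℕ → ℕ → A)
    (hf : ∀ k < n, IsAvoider B n (f k))
    (hne : ∀ k l, k < l → l < n → ∃ i < n, f k i ≠ f l i)
    (hex : ∀ g, IsAvoider B n g → (∀ m < n, ∃ i < n, g i = m) →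
      ∃ k < n, ∀ i j, i < j → j < n → (g i < g j ↔ f k i < f k j)) :
    weightSum S n w = ∑ k ∈ Finset.range n, ∏ i ∈ Finset.range n, w i (f k i) := by
  unfold weightSum
  symm
  refine Finset.sum_bij (fun k hk => (hf k (Finset.mem_range.1 hk)).perm) ?_ ?_ ?_ ?_
  · intro k hk
    have hk := hf k (Finset.mem_range.1 hk)
    simp only [Finset.mem_filter, Finset.mem_univ, true_and]
    rw [hS]
    intro a b c hab hbc
    exact hk.avoids a b c hab hbc c.isLt
  · intro k hk l hl hkl
    have key : ∀ i < n, f k i = f l i := fun i hi => by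
      have := congrArg (fun π : Equiv.Perm (Fin n) => (π ⟨i, hi⟩ : ℕ)) hkl
      simpa using this
    have hk := Finset.mem_range.1 hk
    have hl := Finset.mem_range.1 hl
    rcases lt_trichotomy k l with h | h | h
    · obtain ⟨i, hi, hn⟩ := hne k l h hl
      exact (hn (key i hi)).elim
    · exact h
    · obtain ⟨i, hi, hn⟩ := hne l k h hk
      exact (hn (key i hi).symm).elim
  · intro π hπ
    have hπ := (Finset.mem_filter.1 hπ).2
    have hg := isAvoider_valFun hS hπ
    obtain ⟨k, hk, h⟩ := hex (valFun π) hg fun m hm => valFun_surj π hm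
    refine ⟨k, Finset.mem_range.2 hk, (perm_eq_of_lt_imp_lt fun i j hij => ?_).symm⟩
    simp only [Fin.lt_def, IsAvoider.val_perm]
    rw [Fin.lt_def, ← valFun_val, ← valFun_val] at hij
    rcases lt_trichotomy i j with h1 | h1 | h1
    · exact (h i j h1 j.isLt).1 hij
    · simp [h1] at hij
    · have h2 := h j i h1 i.isLt
      have h3 := (hf k hk).ne j i h1 i.isLt
      omega
  · intro k hk
    rw [← Fin.prod_univ_eq_prod_range fun i => w i (f k i)]
    rfl

/-- An up-closed property of `1, …, n - 1` is given by a threshold. -/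
lemma exists_threshold {n : ℕ} (hn : 0 < n) (P : ℕ → Prop)
    (hP : ∀ i j, 0 < i → i < j → j < n → P i → P j) :
    ∃ t < n, ∀ j, 0 < j → j < n → (P j ↔ t < j) := by
  classical
  have hex : ∃ t, n ≤ t + 1 ∨ P (t + 1) := ⟨n, Or.inl (by omega)⟩
  refine ⟨Nat.find hex, ?_, fun j h0 hj => ⟨fun h => ?_, fun h => ?_⟩⟩
  · have : Nat.find hex ≤ n - 1 := Nat.find_min' hex (Or.inl (by omega))
    omega
  · obtain ⟨i, rfl⟩ : ∃ i, j = i + 1 := ⟨j - 1, by omega⟩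
    exact Nat.lt_succ_of_le (Nat.find_min' hex (Or.inr h))
  · rcases Nat.find_spec hex with h1 | h1
    · omega
    · rcases Nat.lt_or_ge (Nat.find hex + 1) j with h2 | h2
      · exact hP _ _ (by omega) h2 hj h1
      · rwa [show j = Nat.find hex + 1 by omega]

end Families

/-! ### The class listed by comparison with its last entry. -/

section Classes

/-- These are exactly the three patterns whose first two entries ascend, so the third value plays no
role in the condition. -/
lemma avoidsIff_123_132_231 : AvoidsIff {p123, p132, p231} fun a b _ => a < b := by
  intro n π
  rw [avoids_triple, not_contains_p123, not_contains_p132, not_contains_p231]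
  have ne : ∀ {i j : Fin n}, i < j → (π i : ℕ) ≠ π j := fun h =>
    Fin.val_ne_of_ne (π.injective.ne h.ne)
  constructor
  · rintro ⟨h1, h2, h3⟩ a b c hab hbc
    have := h1 a b c hab hbc
    have := h2 a b c hab hbc
    have := h3 a b c hab hbc
    have := ne hab
    have := ne hbc
    have := ne (hab.trans hbc)
    omega
  · intro h
    refine ⟨?_, ?_, ?_⟩ <;> intro a b c hab hbc <;> have := h a b c hab hbc <;> omega

/-- The permutations avoiding `123`, `132` and `231`: decreasing up to the last entry. -/
def family123_132_231 (n k i : ℕ) : ℕ :=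
  if i + 1 < n then (if i < k then n - 1 - i else n - 2 - i) else n - 1 - k

lemma weightSum_123_132_231 {A : Type*} [CommRing A] (n : ℕ) (w : ℕ → ℕ → A) (hn : 0 < n) :
    weightSum {p123, p132, p231} n w =
      ∑ k ∈ Finset.range n, ∏ i ∈ Finset.range n, w i (family123_132_231 n k i) := by
  refine weightSum_eq_sum_family avoidsIff_123_132_231 w (fun k hk => ⟨?_, ?_, ?_⟩) ?_ ?_
  · intro i hi; unfold family123_132_231; split_ifs <;> omega
  · intro i j hi hj; unfold family123_132_231; split_ifs <;> omega
  · intro a b c hab hbc hc; unfold family123_132_231; split_ifs <;> omega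
  · intro k l hkl hl
    refine ⟨n - 1, by omega, ?_⟩
    unfold family123_132_231; split_ifs <;> omega
  · intro g hg _
    have hdec : ∀ i j, i < j → j + 1 < n → g j < g i := fun i j hij hj => by
      have := hg.avoids i j (n - 1) hij (by omega) (by omega)
      have := hg.ne i j hij (by omega)
      omega
    -- All entries but the last decrease, so those below the last one form a final segment. The
    -- index is shifted by one because thresholds are taken on `1, …, n - 1`, whereas the entries to
    -- compare sit at positions `0, …, n - 2`.
    obtain ⟨t, ht, h⟩ := exists_threshold hn (fun j => g (j - 1) < g (n - 1)) (by
      intro i j h0 hij hj hi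
      have := hdec (i - 1) (j - 1) (by omega) (by omega)
      omega)
    refine ⟨t, ht, fun i j hij hj => ?_⟩
    rcases Nat.lt_or_ge (j + 1) n with hj' | hj'
    · have := hdec i j hij hj'
      unfold family123_132_231; split_ifs <;> omega
    · obtain rfl : j = n - 1 := by omega
      have := h (i + 1) (by omega) (by omega)
      simp only [Nat.add_sub_cancel] at this
      rw [this]
      unfold family123_132_231; split_ifs <;> omega

end Classes
-- Classes listed by the first entry or by the position of the smallest entry.
section Classes

/-- These are exactly the three patterns whose last two entries descend. -/
lemma avoidsIff_132_231_321 : AvoidsIff {p132, p231, p321} fun _ b c => c < b := by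
  intro n π
  rw [avoids_triple, not_contains_p132, not_contains_p231, not_contains_p321]
  have ne : ∀ {i j : Fin n}, i < j → (π i : ℕ) ≠ π j := fun h =>
    Fin.val_ne_of_ne (π.injective.ne h.ne)
  constructor
  · rintro ⟨h1, h2, h3⟩ a b c hab hbc
    have := h1 a b c hab hbc
    have := h2 a b c hab hbc
    have := h3 a b c hab hbc
    have := ne hab
    have := ne hbc
    have := ne (hab.trans hbc)
    omega
  · intro h
    refine ⟨?_, ?_, ?_⟩ <;> intro a b c hab hbc <;> have := h a b c hab hbc <;> omega

/-- The permutations avoiding `132`, `231` and `321`: increasing after the first entry. -/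
def family132_231_321 (k i : ℕ) : ℕ :=
  if i = 0 then k else if i ≤ k then i - 1 else i

lemma weightSum_132_231_321 {A : Type*} [CommRing A] (n : ℕ) (w : ℕ → ℕ → A) (hn : 0 < n) :
    weightSum {p132, p231, p321} n w =
      ∑ k ∈ Finset.range n, ∏ i ∈ Finset.range n, w i (family132_231_321 k i) := by
  refine weightSum_eq_sum_family avoidsIff_132_231_321 w (fun k hk => ⟨?_, ?_, ?_⟩) ?_ ?_
  · intro i hi; unfold family132_231_321; split_ifs <;> omega
  · intro i j hi hj; unfold family132_231_321; split_ifs <;> omega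
  · intro a b c hab hbc hc; unfold family132_231_321; split_ifs <;> omega
  · intro k l hkl hl
    refine ⟨0, by omega, ?_⟩
    unfold family132_231_321; split_ifs <;> omega
  · intro g hg _
    have hinc : ∀ i j, 0 < i → i < j → j < n → g i < g j := fun i j h0 hij hj => by
      have := hg.avoids 0 i j h0 hij hj
      have := hg.ne i j hij hj
      omega
    obtain ⟨t, ht, h⟩ := exists_threshold hn (fun j => g 0 < g j) (by
      intro i j h0 hij hj hi
      exact hi.trans (hinc i j h0 hij hj))
    refine ⟨t, ht, fun i j hij hj => ?_⟩
    rcases Nat.eq_zero_or_pos i with rfl | hi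
    · rw [h j hij hj]
      unfold family132_231_321; split_ifs <;> omega
    · have := hinc i j hi hij hj
      unfold family132_231_321; split_ifs <;> omega

lemma avoidsIff_132_213_231 : AvoidsIff {p132, p213, p231} fun a b c =>
    (a < c ∧ c < b) ∨ (b < a ∧ a < c) ∨ (c < a ∧ a < b) := by
  intro n π
  rw [avoids_triple, not_contains_p132, not_contains_p213, not_contains_p231]
  simp only [not_or, ← forall_and]

/-- The permutations avoiding `132`, `213` and `231`: a decreasing prefix of the
largest entries, followed by an increasing sequence. -/
def family132_213_231 (n k i : ℕ) : ℕ :=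
  if i < k then n - 1 - i else i - k

/-- The set contains exactly one pattern with its smallest entry in each of the three positions. So
once the position `m` of the value `0` is known, any two other positions form a triple with `m` in
which one of the two possible orders is forbidden: `m` determines the whole permutation. The next
three classes have the same property and the same argument. -/
lemma weightSum_132_213_231 {A : Type*} [CommRing A] (n : ℕ) (w : ℕ → ℕ → A) (hn : 0 < n) :
    weightSum {p132, p213, p231} n w =
      ∑ k ∈ Finset.range n, ∏ i ∈ Finset.range n, w i (family132_213_231 n k i) := by
  refine weightSum_eq_sum_family avoidsIff_132_213_231 w (fun k hk => ⟨?_, ?_, ?_⟩) ?_ ?_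
  · intro i hi; unfold family132_213_231; split_ifs <;> omega
  · intro i j hi hj; unfold family132_213_231; split_ifs <;> omega
  · intro a b c hab hbc hc; unfold family132_213_231; split_ifs <;> omega
  · intro k l hkl hl
    refine ⟨k, by omega, ?_⟩
    unfold family132_213_231; split_ifs <;> omega
  · intro g hg hsurj
    obtain ⟨m, hm, h0⟩ := hsurj 0 hn
    refine ⟨m, hm, fun i j hij hj => ?_⟩
    have hne := hg.ne i j hij hj
    have pos : ∀ l < n, l ≠ m → 0 < g l := fun l hl hlm => by
      rcases lt_or_gt_of_ne hlm with h | h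
      · have := hg.ne l m h hm; omega
      · have := hg.ne m l h hl; omega
    unfold family132_213_231
    rcases lt_trichotomy j m with hjm | rfl | hjm
    · have := hg.avoids i j m hij hjm hm
      have := pos i (by omega) (by omega)
      have := pos j (by omega) (by omega)
      split_ifs <;> omega
    · have := pos i (by omega) (by omega)
      split_ifs <;> omega
    · have := pos j (by omega) (by omega)
      rcases lt_trichotomy i m with him | rfl | him
      · have := hg.avoids i m j him hjm hj
        have := pos i (by omega) (by omega)
        split_ifs <;> omega
      · split_ifs <;> omega
      · have := hg.avoids m i j him hij hj
        have := pos i (by omega) (by omega)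
        split_ifs <;> omega

lemma avoidsIff_132_231_312 : AvoidsIff {p132, p231, p312} fun a b c =>
    (a < c ∧ c < b) ∨ (c < a ∧ a < b) ∨ (b < c ∧ c < a) := by
  intro n π
  rw [avoids_triple, not_contains_p132, not_contains_p231, not_contains_p312]
  simp only [not_or, ← forall_and]

/-- The permutations avoiding `132`, `231` and `312`: a decreasing prefix of the
smallest entries, followed by an increasing sequence. -/
def family132_231_312 (k i : ℕ) : ℕ :=
  if i ≤ k then k - i else i

lemma weightSum_132_231_312 {A : Type*} [CommRing A] (n : ℕ) (w : ℕ → ℕ → A) (hn : 0 < n) :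
    weightSum {p132, p231, p312} n w =
      ∑ k ∈ Finset.range n, ∏ i ∈ Finset.range n, w i (family132_231_312 k i) := by
  refine weightSum_eq_sum_family avoidsIff_132_231_312 w (fun k hk => ⟨?_, ?_, ?_⟩) ?_ ?_
  · intro i hi; unfold family132_231_312; split_ifs <;> omega
  · intro i j hi hj; unfold family132_231_312; split_ifs <;> omega
  · intro a b c hab hbc hc; unfold family132_231_312; split_ifs <;> omega
  · intro k l hkl hl
    refine ⟨0, by omega, ?_⟩
    unfold family132_231_312; split_ifs <;> omega
  · intro g hg hsurj
    obtain ⟨m, hm, h0⟩ := hsurj 0 hn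
    refine ⟨m, hm, fun i j hij hj => ?_⟩
    have hne := hg.ne i j hij hj
    have pos : ∀ l < n, l ≠ m → 0 < g l := fun l hl hlm => by
      rcases lt_or_gt_of_ne hlm with h | h
      · have := hg.ne l m h hm; omega
      · have := hg.ne m l h hl; omega
    unfold family132_231_312
    rcases lt_trichotomy j m with hjm | rfl | hjm
    · have := hg.avoids i j m hij hjm hm
      have := pos i (by omega) (by omega)
      have := pos j (by omega) (by omega)
      split_ifs <;> omega
    · have := pos i (by omega) (by omega)
      split_ifs <;> omega
    · have := pos j (by omega) (by omega)
      rcases lt_trichotomy i m with him | rfl | him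
      · have := hg.avoids i m j him hjm hj
        have := pos i (by omega) (by omega)
        split_ifs <;> omega
      · split_ifs <;> omega
      · have := hg.avoids m i j him hij hj
        have := pos i (by omega) (by omega)
        split_ifs <;> omega

lemma avoidsIff_123_231_312 : AvoidsIff {p123, p231, p312} fun a b c =>
    (a < b ∧ b < c) ∨ (c < a ∧ a < b) ∨ (b < c ∧ c < a) := by
  intro n π
  rw [avoids_triple, not_contains_p123, not_contains_p231, not_contains_p312]
  simp only [not_or, ← forall_and]

/-- The permutations avoiding `123`, `231` and `312`: direct sums of two decreasing
sequences. -/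
def family123_231_312 (n k i : ℕ) : ℕ :=
  if i ≤ k then k - i else n + k - i

lemma weightSum_123_231_312 {A : Type*} [CommRing A] (n : ℕ) (w : ℕ → ℕ → A) (hn : 0 < n) :
    weightSum {p123, p231, p312} n w =
      ∑ k ∈ Finset.range n, ∏ i ∈ Finset.range n, w i (family123_231_312 n k i) := by
  refine weightSum_eq_sum_family avoidsIff_123_231_312 w (fun k hk => ⟨?_, ?_, ?_⟩) ?_ ?_
  · intro i hi; unfold family123_231_312; split_ifs <;> omega
  · intro i j hi hj; unfold family123_231_312; split_ifs <;> omega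
  · intro a b c hab hbc hc; unfold family123_231_312; split_ifs <;> omega
  · intro k l hkl hl
    refine ⟨0, by omega, ?_⟩
    unfold family123_231_312; split_ifs <;> omega
  · intro g hg hsurj
    obtain ⟨m, hm, h0⟩ := hsurj 0 hn
    refine ⟨m, hm, fun i j hij hj => ?_⟩
    have hne := hg.ne i j hij hj
    have pos : ∀ l < n, l ≠ m → 0 < g l := fun l hl hlm => by
      rcases lt_or_gt_of_ne hlm with h | h
      · have := hg.ne l m h hm; omega
      · have := hg.ne m l h hl; omega
    unfold family123_231_312
    rcases lt_trichotomy j m with hjm | rfl | hjm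
    · have := hg.avoids i j m hij hjm hm
      have := pos i (by omega) (by omega)
      have := pos j (by omega) (by omega)
      split_ifs <;> omega
    · have := pos i (by omega) (by omega)
      split_ifs <;> omega
    · have := pos j (by omega) (by omega)
      rcases lt_trichotomy i m with him | rfl | him
      · have := hg.avoids i m j him hjm hj
        have := pos i (by omega) (by omega)
        split_ifs <;> omega
      · split_ifs <;> omega
      · have := hg.avoids m i j him hij hj
        have := pos i (by omega) (by omega)
        split_ifs <;> omega

lemma avoidsIff_132_213_321 : AvoidsIff {p132, p213, p321} fun a b c =>
    (a < c ∧ c < b) ∨ (b < a ∧ a < c) ∨ (c < b ∧ b < a) := by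
  intro n π
  rw [avoids_triple, not_contains_p132, not_contains_p213, not_contains_p321]
  simp only [not_or, ← forall_and]

/-- The permutations avoiding `132`, `213` and `321`: the rotations. -/
def family132_213_321 (n k i : ℕ) : ℕ :=
  if i < k then n - k + i else i - k

lemma weightSum_132_213_321 {A : Type*} [CommRing A] (n : ℕ) (w : ℕ → ℕ → A) (hn : 0 < n) :
    weightSum {p132, p213, p321} n w =
      ∑ k ∈ Finset.range n, ∏ i ∈ Finset.range n, w i (family132_213_321 n k i) := by
  refine weightSum_eq_sum_family avoidsIff_132_213_321 w (fun k hk => ⟨?_, ?_, ?_⟩) ?_ ?_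
  · intro i hi; unfold family132_213_321; split_ifs <;> omega
  · intro i j hi hj; unfold family132_213_321; split_ifs <;> omega
  · intro a b c hab hbc hc; unfold family132_213_321; split_ifs <;> omega
  · intro k l hkl hl
    refine ⟨0, by omega, ?_⟩
    unfold family132_213_321; split_ifs <;> omega
  · intro g hg hsurj
    obtain ⟨m, hm, h0⟩ := hsurj 0 hn
    refine ⟨m, hm, fun i j hij hj => ?_⟩
    have hne := hg.ne i j hij hj
    have pos : ∀ l < n, l ≠ m → 0 < g l := fun l hl hlm => by
      rcases lt_or_gt_of_ne hlm with h | h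
      · have := hg.ne l m h hm; omega
      · have := hg.ne m l h hl; omega
    unfold family132_213_321
    rcases lt_trichotomy j m with hjm | rfl | hjm
    · have := hg.avoids i j m hij hjm hm
      have := pos i (by omega) (by omega)
      have := pos j (by omega) (by omega)
      split_ifs <;> omega
    · have := pos i (by omega) (by omega)
      split_ifs <;> omega
    · have := pos j (by omega) (by omega)
      rcases lt_trichotomy i m with him | rfl | him
      · have := hg.avoids i m j him hjm hj
        have := pos i (by omega) (by omega)
        split_ifs <;> omega
      · split_ifs <;> omega
      · have := hg.avoids m i j him hij hj
        have := pos i (by omega) (by omega)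
        split_ifs <;> omega

end Classes
-- Geometric and decreasing series; classes that give products of them.
section Series

variable {A : Type*} [CommRing A]

lemma prod_range_eq_pow {n : ℕ} {w : ℕ → A} {a : A} (h : ∀ i < n, w i = a) :
    ∏ i ∈ Finset.range n, w i = a ^ n := by
  rw [Finset.prod_congr rfl fun i hi => h i (Finset.mem_range.1 hi)]
  simp

lemma prod_range_eq_pow_mul_pow {n a b : ℕ} {w : ℕ → A} {s t : A} (hn : n = a + b)
    (hs : ∀ i < a, w i = s) (ht : ∀ i < n, a ≤ i → w i = t) :
    ∏ i ∈ Finset.range n, w i = s ^ a * t ^ b := by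
  subst hn
  rw [Finset.prod_range_add, prod_range_eq_pow hs,
    prod_range_eq_pow fun i hi => ht (a + i) (by omega) (by omega)]

lemma prod_range_eq_pow_mul_pow_mul_pow {n a b c : ℕ} {w : ℕ → A} {s t u : A} (hn : n = a + b + c)
    (hs : ∀ i < a, w i = s) (ht : ∀ i < a + b, a ≤ i → w i = t)
    (hu : ∀ i < n, a + b ≤ i → w i = u) :
    ∏ i ∈ Finset.range n, w i = s ^ a * t ^ b * u ^ c := by
  subst hn
  rw [Finset.prod_range_add, prod_range_eq_pow_mul_pow rfl hs ht,
    prod_range_eq_pow fun i hi => hu (a + b + i) (by omega) (by omega)]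

/-- The weight of the decreasing permutation of length `n`. -/
def decWeight (x q r : A) (n : ℕ) : A := (q * r) ^ (n / 2) * x ^ (n % 2)

/-- The first half of the entries lies above the diagonal and the last half below, with a fixed
point in the middle when `n` is odd. The offset `c` lets the block start anywhere on the diagonal.
-/
lemma prod_decreasing (x q r : A) (c n : ℕ) :
    ∏ i ∈ Finset.range n, entryWeight x q r (c + i) (c + (n - 1 - i)) = decWeight x q r n := by
  rw [prod_range_eq_pow_mul_pow_mul_pow (a := n / 2) (b := n % 2) (c := n / 2) (by omega)
    (fun i hi => entryWeight_of_lt x q r (by omega))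
    (fun i hi hi' => by rw [show n - 1 - i = i by omega, entryWeight_self])
    (fun i hi hi' => entryWeight_of_gt x q r (by omega)), decWeight]
  ring

lemma decWeight_zero (x q r : A) : decWeight x q r 0 = 1 := by simp [decWeight]

lemma decWeight_one (x q r : A) : decWeight x q r 1 = x := by simp [decWeight]

lemma decWeight_add_two (x q r : A) (n : ℕ) :
    decWeight x q r (n + 2) = q * r * decWeight x q r n := by
  simp only [decWeight, Nat.add_mod_right, Nat.add_div_right n two_pos]
  ring

lemma weightSum_zero {S : Set Pattern} {B : ℕ → ℕ → ℕ → Prop} (hS : AvoidsIff S B)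
    (w : ℕ → ℕ → A) : weightSum S 0 w = 1 := by
  classical
  have : ∀ π : Equiv.Perm (Fin 0), Avoids π S := fun π => (hS 0 π).2 fun a => a.elim0
  simp [weightSum, this]

-- This turns recurrences into identities of series: unrolling a series a few times and substituting
-- the recurrence leaves a linear equation for it.
open PowerSeries in
lemma mk_eq_shift (W : ℕ → A) :
    PowerSeries.mk W = C (W 0) + X * PowerSeries.mk fun n => W (n + 1) := by
  ext n
  cases n <;> simp

/-- The geometric series. -/
noncomputable def geom (a : A) : A⟦X⟧ := PowerSeries.mk fun n => a ^ n

/-- The generating function of the decreasing permutations. -/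
noncomputable def decSeries (x q r : A) : A⟦X⟧ := PowerSeries.mk (decWeight x q r)

open PowerSeries in
lemma geom_mul (a : A) : geom a * (1 - C a * X) = 1 := by
  have h : (PowerSeries.mk fun n => a ^ (n + 1)) = C a * geom a := by
    ext n; simp [geom, pow_succ']
  have h1 := mk_eq_shift fun n => a ^ n
  simp only [pow_zero, map_one, h] at h1
  rw [← geom] at h1
  linear_combination h1

open PowerSeries in
lemma decSeries_mul (x q r : A) :
    decSeries x q r * (1 - C q * C r * X ^ 2) = 1 + C x * X := by
  have h1 := mk_eq_shift (decWeight x q r)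
  have h2 := mk_eq_shift fun n => decWeight x q r (n + 1)
  have h : (PowerSeries.mk fun n => decWeight x q r (n + 2)) = C q * C r * decSeries x q r := by
    ext n; simp [decSeries, decWeight_add_two, ← map_mul]
  simp only [decWeight_zero, map_one, zero_add, decWeight_one, add_assoc, Nat.reduceAdd, h] at h1 h2
  rw [← decSeries, h2] at h1
  linear_combination h1

open PowerSeries in
lemma coeff_mk_mul_mk (f g : ℕ → A) (n : ℕ) :
    coeff n (PowerSeries.mk f * PowerSeries.mk g) =
      ∑ k ∈ Finset.range (n + 1), f k * g (n - k) := by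
  rw [coeff_mul]
  simp only [coeff_mk]
  exact Finset.Nat.sum_antidiagonal_eq_sum_range_succ (fun i j => f i * g j) n

-- Isolates the nonempty decreasing blocks. With the factor `X` taken out, a block of length `k + 1`
-- is indexed by `k`, as in the families of the preceding classes.
open PowerSeries in
lemma decSeries_sub_one (x q r : A) :
    decSeries x q r - 1 = X * PowerSeries.mk fun n => decWeight x q r (n + 1) := by
  have h1 := mk_eq_shift (decWeight x q r)
  rw [decWeight_zero, map_one] at h1
  rw [decSeries, h1]
  ring

-- A nonempty avoider is a nonempty decreasing block followed by fixed points, and weights multiply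
-- along direct sums.
open PowerSeries in
lemma genFun_132_231_312 (x q r : A) :
    genFun {p132, p231, p312} x q r = 1 + (decSeries x q r - 1) * geom x := by
  rw [decSeries_sub_one, mul_assoc, genFun, mk_eq_shift, weightSum_zero avoidsIff_132_231_312,
    map_one]
  congr 2
  ext n
  rw [coeff_mk, geom, coeff_mk_mul_mk, weightSum_132_231_312 _ _ n.succ_pos]
  refine Finset.sum_congr rfl fun k hk => ?_
  have hk := Finset.mem_range.1 hk
  rw [show n.succ = (k + 1) + (n - k) by omega, Finset.prod_range_add]
  congr 1
  · rw [← prod_decreasing x q r 0]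
    refine Finset.prod_congr rfl fun i hi => ?_
    have hi := Finset.mem_range.1 hi
    simp [family132_231_312, show i ≤ k by omega]
  · exact prod_range_eq_pow fun i hi => by
      simp [family132_231_312, entryWeight_self, show ¬ k + 1 + i ≤ k by omega]

-- A nonempty avoider is a direct sum of two decreasing blocks, of which only the second may be
-- empty.
open PowerSeries in
lemma genFun_123_231_312 (x q r : A) :
    genFun {p123, p231, p312} x q r = 1 + (decSeries x q r - 1) * decSeries x q r := by
  rw [decSeries_sub_one, mul_assoc, genFun, mk_eq_shift, weightSum_zero avoidsIff_123_231_312,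
    map_one]
  congr 2
  ext n
  rw [coeff_mk, decSeries, coeff_mk_mul_mk, weightSum_123_231_312 _ _ n.succ_pos]
  refine Finset.sum_congr rfl fun k hk => ?_
  have hk := Finset.mem_range.1 hk
  rw [← Finset.prod_range_mul_prod_Ico _ (show k + 1 ≤ n + 1 by omega),
    Finset.prod_Ico_eq_prod_range, show n + 1 - (k + 1) = n - k by omega]
  congr 1
  · rw [← prod_decreasing x q r 0]
    refine Finset.prod_congr rfl fun i hi => ?_
    have hi := Finset.mem_range.1 hi
    simp [family123_231_312, show i ≤ k by omega]
  · rw [← prod_decreasing x q r (k + 1)]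
    refine Finset.prod_congr rfl fun i hi => ?_
    have hi := Finset.mem_range.1 hi
    simp only [family123_231_312, show ¬ k + 1 + i ≤ k by omega, if_false]
    congr 1
    omega

/-- The weighted sums `x ^ n + c * (a ^ (n - 2) + a ^ (n - 3) * b + ⋯ + b ^ (n - 2))`. -/
lemma mk_eq_geom_add_geom_mul_geom (W : ℕ → A) (x a b c : A) (h0 : W 0 = 1)
    (h : ∀ n, W (n + 1) = x ^ (n + 1) +
      ∑ k ∈ Finset.range n, c * (a ^ k * b ^ (n - 1 - k))) :
    PowerSeries.mk W =
      geom x + PowerSeries.C c * PowerSeries.X ^ 2 * (geom a * geom b) := by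
  ext n
  rw [map_add, mul_assoc, PowerSeries.coeff_C_mul, PowerSeries.coeff_X_pow_mul',
    PowerSeries.coeff_mk, geom, PowerSeries.coeff_mk]
  rcases n with _ | _ | n
  · simp [h0]
  · simp [h]
  · simp [geom, coeff_mk_mul_mk, h, Finset.mul_sum]

lemma genFun_132_231_321 (x q r : A) :
    genFun {p132, p231, p321} x q r =
      geom x + PowerSeries.C (q * r) * PowerSeries.X ^ 2 * (geom r * geom x) := by
  refine mk_eq_geom_add_geom_mul_geom _ _ _ _ _ (weightSum_zero avoidsIff_132_231_321 _)
    fun n => ?_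
  rw [weightSum_132_231_321 _ _ n.succ_pos, Finset.sum_range_succ', add_comm]
  congr 1
  · refine prod_range_eq_pow fun i hi => ?_
    rcases i with _ | i
    all_goals simp [family132_231_321, entryWeight]
  · refine Finset.sum_congr rfl fun k hk => ?_
    have hk := Finset.mem_range.1 hk
    -- The first entry `k + 1` is an excedance, the `k + 1` entries after it move down by one, and
    -- the rest are fixed.
    rw [prod_range_eq_pow_mul_pow_mul_pow (a := 1) (b := k + 1) (c := n - 1 - k) (s := q) (t := r)
      (u := x) (by omega)]
    · ring
    · intro i hi
      apply entryWeight_of_lt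
      unfold family132_231_321; split_ifs <;> omega
    · intro i hi hi'
      apply entryWeight_of_gt
      unfold family132_231_321; split_ifs <;> omega
    · intro i hi hi'
      rw [family132_231_321, if_neg (by omega), if_neg (by omega), entryWeight_self]

lemma genFun_132_213_321 (x q r : A) :
    genFun {p132, p213, p321} x q r =
      geom x + PowerSeries.C (q * r) * PowerSeries.X ^ 2 * (geom q * geom r) := by
  refine mk_eq_geom_add_geom_mul_geom _ _ _ _ _ (weightSum_zero avoidsIff_132_213_321 _)
    fun n => ?_
  rw [weightSum_132_213_321 _ _ n.succ_pos, Finset.sum_range_succ', add_comm]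
  congr 1
  · refine prod_range_eq_pow fun i hi => ?_
    simp [family132_213_321, entryWeight]
  · refine Finset.sum_congr rfl fun k hk => ?_
    have hk := Finset.mem_range.1 hk
    -- A nontrivial rotation has no fixed points: its first `k + 1` entries are excedances and the
    -- other `n - k` are anti-excedances.
    rw [prod_range_eq_pow_mul_pow (a := k + 1) (b := n - k) (s := q) (t := r) (by omega)]
    · rw [show n - k = n - 1 - k + 1 by omega]; ring
    · intro i hi
      apply entryWeight_of_lt
      unfold family132_213_321; split_ifs <;> omega
    · intro i hi hi'
      apply entryWeight_of_gt
      unfold family132_213_321; split_ifs <;> omega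

end Series
-- Classes whose weights depend on the side of the middle on which a decreasing run breaks.
section TwoBlocks

variable {A : Type*} [CommRing A]

/-- The first term is the case of a fixed last entry. If the last entry is lowered by at most `n /
2`, the entries raised to make room were excedances already, so the weight is that of a decreasing
block of length `n` times `r`. If it is lowered further, the result differs from the decreasing
permutation of length `n + 1` only below the diagonal, and the weight is the same. -/
lemma weightSum_123_132_231_succ (x q r : A) (n : ℕ) :
    weightSum {p123, p132, p231} (n + 1) (entryWeight x q r) =
      x * decWeight x q r n + (n / 2 : ℕ) * (r * decWeight x q r n) +
        ((n + 1) / 2 : ℕ) * decWeight x q r (n + 1) := by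
  rw [weightSum_123_132_231 _ _ n.succ_pos, Finset.sum_range_succ',
    ← Finset.sum_range_add_sum_Ico _ (show n / 2 ≤ n by omega)]
  have h1 : ∀ k < n / 2, ∏ i ∈ Finset.range (n + 1),
      entryWeight x q r i (family123_132_231 (n + 1) (k + 1) i) = r * decWeight x q r n := by
    intro k hk
    rw [Finset.prod_range_succ, mul_comm, ← prod_decreasing x q r 0]
    congr 1
    · apply entryWeight_of_gt
      unfold family123_132_231; split_ifs <;> omega
    · refine Finset.prod_congr rfl fun i hi => ?_
      have hi := Finset.mem_range.1 hi
      unfold family123_132_231 entryWeight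
      split_ifs <;> first | rfl | omega
  have h2 : ∀ k < n, n / 2 ≤ k → ∏ i ∈ Finset.range (n + 1),
      entryWeight x q r i (family123_132_231 (n + 1) (k + 1) i) = decWeight x q r (n + 1) := by
    intro k hk hk'
    rw [← prod_decreasing x q r 0]
    refine Finset.prod_congr rfl fun i hi => ?_
    have hi := Finset.mem_range.1 hi
    unfold family123_132_231 entryWeight
    split_ifs <;> first | rfl | omega
  have h3 : ∏ i ∈ Finset.range (n + 1),
      entryWeight x q r i (family123_132_231 (n + 1) 0 i) = x * decWeight x q r n := by
    rw [Finset.prod_range_succ, mul_comm, ← prod_decreasing x q r 0]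
    congr 1
    · simp [family123_132_231, entryWeight]
    · refine Finset.prod_congr rfl fun i hi => ?_
      have hi := Finset.mem_range.1 hi
      unfold family123_132_231 entryWeight
      split_ifs <;> first | rfl | omega
  rw [h3, Finset.sum_congr rfl fun k hk => h1 k (Finset.mem_range.1 hk),
    Finset.sum_congr rfl fun k hk => h2 k (Finset.mem_Ico.1 hk).2 (Finset.mem_Ico.1 hk).1]
  simp only [Finset.sum_const, Finset.card_range, Nat.card_Ico, nsmul_eq_mul,
    show n - n / 2 = (n + 1) / 2 by omega]
  ring

open PowerSeries in
lemma mk_half_mul_decWeight (x q r : A) :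
    (PowerSeries.mk fun n => (n / 2 : ℕ) * decWeight x q r n) * (1 - C q * C r * X ^ 2) =
      C q * C r * X ^ 2 * decSeries x q r := by
  have h0 := mk_eq_shift fun n => (n / 2 : ℕ) * decWeight x q r n
  have h1 := mk_eq_shift fun n => ((n + 1) / 2 : ℕ) * decWeight x q r (n + 1)
  -- Two further entries contribute the factor `q * r` and raise `n / 2` by one, which adds a copy
  -- of `decSeries`.
  have h2 : (PowerSeries.mk fun n => ((n + 1 + 1) / 2 : ℕ) * decWeight x q r (n + 1 + 1)) =
      C q * C r * ((PowerSeries.mk fun n => (n / 2 : ℕ) * decWeight x q r n) +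
        decSeries x q r) := by
    ext n
    rw [mul_assoc]
    simp only [coeff_mk, coeff_C_mul, map_add, decSeries, decWeight_add_two,
      show (n + 1 + 1) / 2 = n / 2 + 1 by omega, Nat.cast_add, Nat.cast_one]
    ring
  rw [h2] at h1
  rw [h1] at h0
  simp at h0
  linear_combination h0

open PowerSeries in
lemma genFun_123_132_231 (x q r : A) :
    genFun {p123, p132, p231} x q r * (1 - C q * C r * X ^ 2) ^ 2 =
      (1 - C q * C r * X ^ 2) ^ 2 + C x * X * (1 + C x * X) * (1 - C q * C r * X ^ 2) +
        (1 + C r * X) * (C q * C r * X ^ 2) * (1 + C x * X) := by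
  have h0 := mk_eq_shift fun n => (n / 2 : ℕ) * decWeight x q r n
  have hG := mk_half_mul_decWeight x q r
  have hD := decSeries_mul x q r
  have hF : genFun {p123, p132, p231} x q r = 1 + X * (C x * decSeries x q r +
      C r * (PowerSeries.mk fun n => (n / 2 : ℕ) * decWeight x q r n) +
      PowerSeries.mk fun n => ((n + 1) / 2 : ℕ) * decWeight x q r (n + 1)) := by
    rw [genFun, mk_eq_shift, weightSum_zero avoidsIff_123_132_231, map_one]
    congr 2
    ext n
    simp only [coeff_mk, weightSum_123_132_231_succ, map_add, coeff_C_mul, decSeries]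
    ring
  simp only [Nat.zero_div, Nat.cast_zero, zero_mul, map_zero, zero_add] at h0
  set G := PowerSeries.mk fun n => (n / 2 : ℕ) * decWeight x q r n
  set D := decSeries x q r
  set y : A⟦X⟧ := C q * C r * X ^ 2
  rw [hF]
  linear_combination -(1 - y) ^ 2 * h0 + (1 + C r * X) * (1 - y) * hG +
    (C x * X * (1 - y) + (1 + C r * X) * y) * hD

/-- A nonempty prefix that ends before the middle consists of excedances, and everything after it is
an anti-excedance. A prefix reaching further follows the decreasing permutation through the middle
and differs from it only below the diagonal. -/
lemma weightSum_132_213_231_succ (x q r : A) (n : ℕ) :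
    weightSum {p132, p213, p231} (n + 1) (entryWeight x q r) =
      x ^ (n + 1) + ∑ k ∈ Finset.range ((n + 1) / 2), q ^ (k + 1) * r ^ (n - k) +
        (n / 2 : ℕ) * decWeight x q r (n + 1) := by
  rw [weightSum_132_213_231 _ _ n.succ_pos, Finset.sum_range_succ',
    ← Finset.sum_range_add_sum_Ico _ (show (n + 1) / 2 ≤ n by omega)]
  have h1 : ∀ k < (n + 1) / 2, ∏ i ∈ Finset.range (n + 1),
      entryWeight x q r i (family132_213_231 (n + 1) (k + 1) i) = q ^ (k + 1) * r ^ (n - k) := by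
    intro k hk
    refine prod_range_eq_pow_mul_pow (by omega) (fun i hi => ?_) (fun i hi hi' => ?_)
    · apply entryWeight_of_lt
      unfold family132_213_231; split_ifs <;> omega
    · apply entryWeight_of_gt
      unfold family132_213_231; split_ifs <;> omega
  have h2 : ∀ k < n, (n + 1) / 2 ≤ k → ∏ i ∈ Finset.range (n + 1),
      entryWeight x q r i (family132_213_231 (n + 1) (k + 1) i) = decWeight x q r (n + 1) := by
    intro k hk hk'
    rw [← prod_decreasing x q r 0]
    refine Finset.prod_congr rfl fun i hi => ?_
    have hi := Finset.mem_range.1 hi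
    unfold family132_213_231 entryWeight
    split_ifs <;> first | rfl | omega
  have h3 : ∏ i ∈ Finset.range (n + 1),
      entryWeight x q r i (family132_213_231 (n + 1) 0 i) = x ^ (n + 1) :=
    prod_range_eq_pow fun i hi => by simp [family132_213_231, entryWeight]
  rw [h3, Finset.sum_congr rfl fun k hk => h1 k (Finset.mem_range.1 hk),
    Finset.sum_congr rfl fun k hk => h2 k (Finset.mem_Ico.1 hk).2 (Finset.mem_Ico.1 hk).1]
  simp only [Finset.sum_const, Nat.card_Ico, nsmul_eq_mul,
    show n - (n + 1) / 2 = n / 2 by omega]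
  ring

open PowerSeries in
lemma genFun_132_213_231 (x q r : A) :
    genFun {p132, p213, p231} x q r *
        ((1 - C r * X) * (1 - C x * X) * (1 - C q * C r * X ^ 2) ^ 2) =
      (1 - C r * X) * (1 - C q * C r * X ^ 2) ^ 2 +
        C q * C r * X ^ 2 * (1 - C x * X) * (1 - C q * C r * X ^ 2) +
        C q * C r * X ^ 2 * (C q * C r * X ^ 2 + C x * X) * (1 - C r * X) * (1 - C x * X) := by
  have hx := geom_mul x
  have hr := geom_mul r
  have hD := decSeries_mul x q r
  -- Raising `n` by two multiplies the old terms by `q * r` and adds the term `q * r ^ (n + 1)`,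
  -- which accounts for the geometric series in `r`.
  have hE : (PowerSeries.mk fun n => ∑ k ∈ Finset.range (n / 2), q ^ (k + 1) * r ^ (n - 1 - k)) *
      (1 - C q * C r * X ^ 2) = C q * C r * X ^ 2 * geom r := by
    have h0 := mk_eq_shift fun n => ∑ k ∈ Finset.range (n / 2), q ^ (k + 1) * r ^ (n - 1 - k)
    have h1 := mk_eq_shift fun n =>
      ∑ k ∈ Finset.range ((n + 1) / 2), q ^ (k + 1) * r ^ (n + 1 - 1 - k)
    have h2 : (PowerSeries.mk fun n =>
        ∑ k ∈ Finset.range ((n + 1 + 1) / 2), q ^ (k + 1) * r ^ (n + 1 + 1 - 1 - k)) =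
        C q * C r * ((PowerSeries.mk fun n =>
          ∑ k ∈ Finset.range (n / 2), q ^ (k + 1) * r ^ (n - 1 - k)) + geom r) := by
      ext n
      rw [mul_assoc]
      simp only [coeff_mk, coeff_C_mul, map_add, geom,
        show (n + 1 + 1) / 2 = n / 2 + 1 by omega]
      rw [Finset.sum_range_succ', mul_add, mul_add, Finset.mul_sum, Finset.mul_sum]
      congr 1
      · refine Finset.sum_congr rfl fun k hk => ?_
        have hk := Finset.mem_range.1 hk
        rw [show n + 1 + 1 - 1 - (k + 1) = n - 1 - k + 1 by omega]
        ring
      · simp only [Nat.add_sub_cancel, Nat.sub_zero]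
        ring
    rw [h2] at h1
    rw [h1] at h0
    simp at h0
    linear_combination h0
  -- The step from `n` to `n + 2` fails at `n = 0`, where `n - 1` truncates. The recurrence is
  -- therefore used from length one on, and `decSeries - 1` replaces `decSeries`.
  have hB : (PowerSeries.mk fun n => ((n - 1) / 2 : ℕ) * decWeight x q r n) *
      (1 - C q * C r * X ^ 2) = C q * C r * X ^ 2 * (decSeries x q r - 1) := by
    have h0 := mk_eq_shift fun n => ((n - 1) / 2 : ℕ) * decWeight x q r n
    have h1 := mk_eq_shift fun n => ((n + 1 - 1) / 2 : ℕ) * decWeight x q r (n + 1)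
    have h2 := mk_eq_shift fun n => ((n + 1 + 1 - 1) / 2 : ℕ) * decWeight x q r (n + 1 + 1)
    have h3 : (PowerSeries.mk fun n =>
        ((n + 1 + 1 + 1 - 1) / 2 : ℕ) * decWeight x q r (n + 1 + 1 + 1)) =
        C q * C r * ((PowerSeries.mk fun n => ((n + 1 - 1) / 2 : ℕ) * decWeight x q r (n + 1)) +
          PowerSeries.mk fun n => decWeight x q r (n + 1)) := by
      ext n
      rw [mul_assoc]
      simp only [coeff_mk, coeff_C_mul, map_add, decWeight_add_two,
        show (n + 1 + 1 + 1 - 1) / 2 = (n + 1 - 1) / 2 + 1 by omega, Nat.cast_add, Nat.cast_one]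
      ring
    rw [h3] at h2
    simp only [Nat.zero_sub, Nat.zero_div, Nat.cast_zero, zero_mul, map_zero, zero_add,
      Nat.sub_self, Nat.reduceAdd, Nat.reduceSub, Nat.reduceDiv] at h0 h1 h2
    have h4 := decSeries_sub_one x q r
    linear_combination (1 - C q * C r * X ^ 2) * h0 + X * h1 + X ^ 2 * h2 -
      C q * C r * X ^ 2 * h4
  have hF : genFun {p132, p213, p231} x q r = geom x +
      (PowerSeries.mk fun n => ∑ k ∈ Finset.range (n / 2), q ^ (k + 1) * r ^ (n - 1 - k)) +
      PowerSeries.mk fun n => ((n - 1) / 2 : ℕ) * decWeight x q r n := by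
    ext n
    rcases n with _ | n
    · simp [genFun, weightSum_zero avoidsIff_132_213_231, geom]
    · simp only [genFun, coeff_mk, weightSum_132_213_231_succ, map_add, geom,
        Nat.add_sub_cancel]
  set E := PowerSeries.mk fun n => ∑ k ∈ Finset.range (n / 2), q ^ (k + 1) * r ^ (n - 1 - k)
  set B := PowerSeries.mk fun n => ((n - 1) / 2 : ℕ) * decWeight x q r n
  set D := decSeries x q r
  set y : A⟦X⟧ := C q * C r * X ^ 2
  rw [hF]
  linear_combination (1 - C r * X) * (1 - y) ^ 2 * hx +
    (1 - C r * X) * (1 - C x * X) * (1 - y) * (hE + hB) +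
    (1 - C x * X) * (1 - y) * y * hr + (1 - C r * X) * (1 - C x * X) * y * hD

end TwoBlocks
-- Layered permutations with blocks `1` and `21`.
section Layered

/-- The patterns `231` and `321` merge into one condition: the last of the three values is the
smallest. -/
lemma avoidsIff_231_312_321 : AvoidsIff {p231, p312, p321} fun a b c =>
    (c < a ∧ c < b) ∨ (b < c ∧ c < a) := by
  intro n π
  rw [avoids_triple, not_contains_p231, not_contains_p312, not_contains_p321]
  have ne : ∀ {i j : Fin n}, i < j → (π i : ℕ) ≠ π j := fun h =>
    Fin.val_ne_of_ne (π.injective.ne h.ne)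
  constructor
  · rintro ⟨h1, h2, h3⟩ a b c hab hbc
    have := h1 a b c hab hbc
    have := h2 a b c hab hbc
    have := h3 a b c hab hbc
    have := ne hab
    omega
  · intro h
    refine ⟨?_, ?_, ?_⟩ <;> intro a b c hab hbc <;> have := h a b c hab hbc <;> omega

/-- The direct sum of `1` and a permutation. -/
def oneSum {n : ℕ} (e : Equiv.Perm (Fin n)) : Equiv.Perm (Fin (n + 1)) :=
  Equiv.Perm.decomposeFin.symm (0, e)

/-- The direct sum of `21` and a permutation. -/
def twoSum {n : ℕ} (e : Equiv.Perm (Fin n)) : Equiv.Perm (Fin (n + 2)) :=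
  Equiv.Perm.decomposeFin.symm (1, oneSum e)

@[simp] lemma oneSum_zero {n : ℕ} (e : Equiv.Perm (Fin n)) : oneSum e 0 = 0 := by
  simp [oneSum]

@[simp] lemma oneSum_succ {n : ℕ} (e : Equiv.Perm (Fin n)) (i : Fin n) :
    oneSum e i.succ = (e i).succ := by
  simp [oneSum]

@[simp] lemma twoSum_zero {n : ℕ} (e : Equiv.Perm (Fin n)) : twoSum e 0 = 1 := by
  simp [twoSum]

@[simp] lemma twoSum_one {n : ℕ} (e : Equiv.Perm (Fin n)) : twoSum e 1 = 0 := by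
  rw [← Fin.succ_zero_eq_one, twoSum, Equiv.Perm.decomposeFin_symm_apply_succ]
  simp

@[simp] lemma twoSum_succ_succ {n : ℕ} (e : Equiv.Perm (Fin n)) (i : Fin n) :
    twoSum e i.succ.succ = (e i).succ.succ := by
  rw [twoSum, Equiv.Perm.decomposeFin_symm_apply_succ, oneSum_succ]
  refine Equiv.swap_apply_of_ne_of_ne (Fin.succ_ne_zero _) ?_
  rw [← Fin.succ_zero_eq_one]
  exact fun h => Fin.succ_ne_zero _ (Fin.succ_injective _ h)

lemma avoids_oneSum {n : ℕ} (e : Equiv.Perm (Fin n)) :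
    Avoids (oneSum e) {p231, p312, p321} ↔ Avoids e {p231, p312, p321} := by
  rw [avoidsIff_231_312_321, avoidsIff_231_312_321]
  constructor
  · intro h a b c hab hbc
    have := h a.succ b.succ c.succ (by simpa using hab) (by simpa using hbc)
    simp only [oneSum_succ, Fin.val_succ] at this
    omega
  · intro h a b c hab hbc
    cases a using Fin.cases with
    | zero => simp
    | succ a =>
      cases b using Fin.cases with
      | zero => exact absurd hab (Fin.not_lt_zero _)
      | succ b =>
        cases c using Fin.cases with
        | zero => exact absurd hbc (Fin.not_lt_zero _)
        | succ c =>
          have := h a b c (by simpa using hab) (by simpa using hbc)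
          simp only [oneSum_succ, Fin.val_succ]
          omega

lemma avoids_twoSum {n : ℕ} (e : Equiv.Perm (Fin n)) :
    Avoids (twoSum e) {p231, p312, p321} ↔ Avoids e {p231, p312, p321} := by
  rw [avoidsIff_231_312_321, avoidsIff_231_312_321]
  constructor
  · intro h a b c hab hbc
    have := h a.succ.succ b.succ.succ c.succ.succ (by simpa using hab) (by simpa using hbc)
    simp only [twoSum_succ_succ, Fin.val_succ] at this
    omega
  · intro h a b c hab hbc
    have hc : 2 ≤ (c : ℕ) := by rw [Fin.lt_def] at hab hbc; omega
    obtain ⟨c, rfl⟩ : ∃ d : Fin n, c = d.succ.succ :=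
      ⟨⟨c - 2, by omega⟩, Fin.ext (by simp; omega)⟩
    cases a using Fin.cases with
    | zero => simp
    | succ a =>
      cases a using Fin.cases with
      | zero => simp
      | succ a =>
        have hb : 2 ≤ (b : ℕ) := by rw [Fin.lt_def] at hab; simp at hab; omega
        obtain ⟨b, rfl⟩ : ∃ d : Fin n, b = d.succ.succ :=
          ⟨⟨b - 2, by omega⟩, Fin.ext (by simp; omega)⟩
        have := h a b c (by simpa using hab) (by simpa using hbc)
        simp only [twoSum_succ_succ, Fin.val_succ]
        omega

lemma oneSum_injective {n : ℕ} : Function.Injective (oneSum (n := n)) := fun e f h => by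
  simpa [oneSum] using h

lemma twoSum_injective {n : ℕ} : Function.Injective (twoSum (n := n)) := fun e f h => by
  have : oneSum e = oneSum f := by simpa [twoSum] using h
  exact oneSum_injective this

lemma exists_oneSum {n : ℕ} {π : Equiv.Perm (Fin (n + 1))} (h : π 0 = 0) : ∃ e, oneSum e = π := by
  obtain ⟨⟨p, e⟩, rfl⟩ := Equiv.Perm.decomposeFin.symm.surjective π
  obtain rfl : p = 0 := by simpa using h
  exact ⟨e, rfl⟩

lemma exists_twoSum {n : ℕ} {π : Equiv.Perm (Fin (n + 2))} (h : π 0 = 1) (h' : π 1 = 0) :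
    ∃ e, twoSum e = π := by
  obtain ⟨⟨p, e⟩, rfl⟩ := Equiv.Perm.decomposeFin.symm.surjective π
  obtain rfl : p = 1 := by simpa using h
  rw [← Fin.succ_zero_eq_one, Equiv.Perm.decomposeFin_symm_apply_succ, Equiv.swap_apply_eq_iff,
    Fin.succ_zero_eq_one, Equiv.swap_apply_left, ← Fin.succ_zero_eq_one] at h'
  obtain ⟨f, rfl⟩ := exists_oneSum (Fin.succ_injective _ h')
  exact ⟨f, rfl⟩

/-- Two later entries below the first would complete `312` or `321`, so the first value is `0` or
`1`. If it is `1`, the value `0` must come next, since an entry in between would give a triple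
ending in its smallest value. -/
lemma eq_oneSum_or_eq_twoSum {n : ℕ} {π : Equiv.Perm (Fin (n + 2))}
    (h : Avoids π {p231, p312, p321}) : (∃ e, oneSum e = π) ∨ ∃ e, twoSum e = π := by
  have hg := isAvoider_valFun avoidsIff_231_312_321 h
  obtain ⟨i, hi, hi0⟩ := valFun_surj π (show 0 < n + 2 by omega)
  obtain ⟨j, hj, hj1⟩ := valFun_surj π (show 1 < n + 2 by omega)
  have hv : ∀ l : Fin (n + 2), valFun π l = π l := valFun_val π
  have key : ∀ l m, l < m → m < n + 2 → 0 < l → valFun π l < valFun π 0 →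
      ¬ valFun π m < valFun π 0 := fun l m hlm hm hl h1 h2 => by
    have := hg.avoids 0 l m hl hlm hm
    have := hg.ne l m hlm hm
    omega
  rcases Nat.eq_zero_or_pos i with rfl | hi'
  · exact Or.inl (exists_oneSum (Fin.ext (by simpa [hi0] using (hv 0).symm)))
  · right
    have h0 := hg.ne 0 i hi' hi
    have hj0 : j = 0 := by
      by_contra hj0
      have := hg.ne 0 j (by omega) hj
      rcases lt_trichotomy i j with h1 | h1 | h1
      · exact key i j h1 hj (by omega) (by omega) (by omega)
      · subst h1; omega
      · exact key j i h1 hi (by omega) (by omega) (by omega)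
    subst hj0
    have hi1 : i = 1 := by
      by_contra hi1
      have := hg.avoids 0 1 i (by omega) (by omega) hi
      have := hg.ne 1 i (by omega) hi
      omega
    subst hi1
    exact exists_twoSum (Fin.ext (by simpa [hj1] using (hv 0).symm))
      (Fin.ext (by simpa [hi0] using (hv 1).symm))

variable {A : Type*} [CommRing A]

lemma weightSum_231_312_321_one (w : ℕ → ℕ → A) :
    weightSum {p231, p312, p321} 1 w = w 0 0 := by
  classical
  have : ∀ π : Equiv.Perm (Fin 1), Avoids π {p231, p312, p321} := fun π =>
    (avoidsIff_231_312_321 1 π).2 fun a b c hab => absurd hab (by simp [Subsingleton.elim a b])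
  simp [weightSum, this]

/-- The weight is left arbitrary because the recurrence is used again below with weights that are
not constant along diagonals. -/
lemma weightSum_231_312_321_add_two (n : ℕ) (w : ℕ → ℕ → A) :
    weightSum {p231, p312, p321} (n + 2) w =
      w 0 0 * weightSum {p231, p312, p321} (n + 1) (fun i j => w (i + 1) (j + 1)) +
      w 0 1 * w 1 0 * weightSum {p231, p312, p321} n (fun i j => w (i + 2) (j + 2)) := by
  classical
  have hu : (Finset.univ.filter fun π : Equiv.Perm (Fin (n + 2)) =>
      Avoids π {p231, p312, p321}) =
      ((Finset.univ.filter fun e => Avoids e {p231, p312, p321}).map ⟨oneSum, oneSum_injective⟩) ∪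
      ((Finset.univ.filter fun e => Avoids e {p231, p312, p321}).map
        ⟨twoSum, twoSum_injective⟩) := by
    ext π
    simp only [Finset.mem_filter, Finset.mem_univ, true_and, Finset.mem_union, Finset.mem_map,
      Function.Embedding.coeFn_mk]
    constructor
    · intro h
      rcases eq_oneSum_or_eq_twoSum h with ⟨e, rfl⟩ | ⟨e, rfl⟩
      · exact Or.inl ⟨e, (avoids_oneSum e).1 h, rfl⟩
      · exact Or.inr ⟨e, (avoids_twoSum e).1 h, rfl⟩
    · rintro (⟨e, h, rfl⟩ | ⟨e, h, rfl⟩)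
      · exact (avoids_oneSum e).2 h
      · exact (avoids_twoSum e).2 h
  unfold weightSum
  rw [hu, Finset.sum_union, Finset.sum_map, Finset.sum_map, Finset.mul_sum, Finset.mul_sum]
  · congr 1
    · refine Finset.sum_congr rfl fun e _ => ?_
      rw [Fin.prod_univ_succ]
      simp
    · refine Finset.sum_congr rfl fun e _ => ?_
      rw [Fin.prod_univ_succ, Fin.prod_univ_succ]
      simp [mul_assoc]
  · rw [Finset.disjoint_left]
    intro π h1 h2
    obtain ⟨e, -, rfl⟩ := Finset.mem_map.1 h1
    obtain ⟨f, -, h⟩ := Finset.mem_map.1 h2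
    have := congrArg (fun π : Equiv.Perm (Fin (n + 2)) => π 0) h
    simp at this

open PowerSeries in
lemma genFun_231_312_321 (x q r : A) :
    genFun {p231, p312, p321} x q r * (1 - C x * X - C q * C r * X ^ 2) = 1 := by
  -- `entryWeight` is constant along diagonals, so the shifted sums in the recurrence are sums of
  -- the same kind.
  have hs : ∀ c, (fun i j => entryWeight x q r (i + c) (j + c)) = entryWeight x q r := fun c => by
    ext i j; simp [entryWeight]
  have h0 := mk_eq_shift fun n => weightSum {p231, p312, p321} n (entryWeight x q r)
  have h1 := mk_eq_shift fun n => weightSum {p231, p312, p321} (n + 1) (entryWeight x q r)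
  have h2 : (PowerSeries.mk fun n =>
      weightSum {p231, p312, p321} (n + 1 + 1) (entryWeight x q r)) =
      C x * (PowerSeries.mk fun n => weightSum {p231, p312, p321} (n + 1) (entryWeight x q r)) +
      C q * C r * PowerSeries.mk fun n => weightSum {p231, p312, p321} n (entryWeight x q r) := by
    ext n
    rw [mul_assoc]
    simp only [coeff_mk, map_add, coeff_C_mul, weightSum_231_312_321_add_two, hs]
    simp [entryWeight, mul_assoc]
  rw [h2] at h1
  rw [weightSum_zero avoidsIff_231_312_321, map_one] at h0
  simp only [zero_add, weightSum_231_312_321_one, entryWeight_self] at h1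
  rw [genFun]
  linear_combination (1 - C x * X) * h0 + X * h1

end Layered

/-! ### Reverse layered permutations and Fibonacci numbers. -/

section ReverseLayered

variable {A : Type*} [CommRing A]

/-- Complementing values sends `123`, `132`, `213` to `321`, `312`, `231`. A comparison of `i` with
the old value becomes one of `i` plus the new value with `n - 1`, so the diagonal turns into an
antidiagonal. -/
lemma weightSum_123_132_213 (n : ℕ) (w : ℕ → ℕ → A) :
    weightSum {p123, p132, p213} n w =
      weightSum {p231, p312, p321} n (fun i j => w i (n - 1 - j)) := by
  classical
  have key : ∀ π : Equiv.Perm (Fin n), Avoids (Fin.revPerm * π) {p231, p312, p321} ↔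
      Avoids π {p123, p132, p213} := by
    intro π
    rw [avoids_triple, avoids_triple, not_contains_p231, not_contains_p312, not_contains_p321,
      not_contains_p123, not_contains_p132, not_contains_p213]
    have h : ∀ i j : Fin n, ((Fin.revPerm * π : Equiv.Perm (Fin n)) i : ℕ) <
        (Fin.revPerm * π : Equiv.Perm (Fin n)) j ↔ (π j : ℕ) < π i := fun i j => by
      simp only [Equiv.Perm.mul_apply, Fin.revPerm_apply, ← Fin.lt_def, Fin.rev_lt_rev]
    simp only [h]
    constructor
    · rintro ⟨h1, h2, h3⟩
      refine ⟨fun a b c hab hbc hh => h3 a b c hab hbc hh.symm, fun a b c hab hbc hh =>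
        h2 a b c hab hbc hh.symm, fun a b c hab hbc hh => h1 a b c hab hbc hh.symm⟩
    · rintro ⟨h1, h2, h3⟩
      refine ⟨fun a b c hab hbc hh => h3 a b c hab hbc hh.symm, fun a b c hab hbc hh =>
        h2 a b c hab hbc hh.symm, fun a b c hab hbc hh => h1 a b c hab hbc hh.symm⟩
  have hrev : ∀ π : Equiv.Perm (Fin n), Fin.revPerm * (Fin.revPerm * π) = π := fun π => by
    ext i; simp
  unfold weightSum
  refine Finset.sum_nbij' (fun π => Fin.revPerm * π) (fun π => Fin.revPerm * π) ?_ ?_ ?_ ?_ ?_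
  · intro π h
    simpa [key] using h
  · intro π h
    have := (Finset.mem_filter.1 h).2
    rw [← hrev π, key] at this
    simpa using this
  · intro π _
    exact hrev π
  · intro π _
    exact hrev π
  · intro π _
    refine Finset.prod_congr rfl fun i _ => ?_
    have := (π i).isLt
    simp only [Equiv.Perm.mul_apply, Fin.revPerm_apply, Fin.val_rev]
    congr 1
    omega

/-- The weighted sum over layered permutations of length `m` placed at `(c, c)`, where the
weight of an entry depends only on the antidiagonal that contains it. -/
noncomputable def layeredSum (u : ℕ → A) (c m : ℕ) : A :=
  weightSum {p231, p312, p321} m fun i j => u (2 * c + (i + j))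

lemma layeredSum_zero (u : ℕ → A) (c : ℕ) : layeredSum u c 0 = 1 :=
  weightSum_zero avoidsIff_231_312_321 _

lemma layeredSum_one (u : ℕ → A) (c : ℕ) : layeredSum u c 1 = u (2 * c) :=
  weightSum_231_312_321_one _

/-- Both entries of a `21` block lie on the same antidiagonal, hence the square. -/
lemma layeredSum_add_two (u : ℕ → A) (c m : ℕ) : layeredSum u c (m + 2) =
    u (2 * c) * layeredSum u (c + 1) (m + 1) + u (2 * c + 1) ^ 2 * layeredSum u (c + 2) m := by
  rw [layeredSum, weightSum_231_312_321_add_two, layeredSum, layeredSum, sq]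
  congr 4
  · ext i j; congr 1; ring
  · ext i j; congr 1; ring

/-- Fibonacci numbers count the compositions of `m` into parts `1` and `2`. -/
lemma layeredSum_const {u : ℕ → A} {r : A} (m : ℕ) : ∀ c, (∀ k, 2 * c ≤ k → u k = r) →
    layeredSum u c m = r ^ m * Nat.fib (m + 1) := by
  induction m using Nat.strong_induction_on with
  | _ m ih =>
    intro c h
    rcases m with _ | _ | m
    · simp [layeredSum_zero]
    · simp [layeredSum_one, h]
    · rw [layeredSum_add_two, ih (m + 1) (by omega) (c + 1) fun k hk => h k (by omega),
        ih m (by omega) (c + 2) fun k hk => h k (by omega), h _ le_rfl, h _ (by omega),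
        Nat.fib_add_two (n := m + 1)]
      push_cast
      ring

/-- Cut after the first `j` positions: either a block ends there, or a `21` block straddles the cut.
In the latter case the antidiagonal of that block is `2 * j - 1`, so both of its entries still weigh
`q`. -/
lemma layeredSum_prefix {u : ℕ → A} {q : A} (j : ℕ) : ∀ m, (∀ k, k < 2 * j → u k = q) →
    layeredSum u 0 (j + m + 1) = q ^ j * (Nat.fib (j + 1) * layeredSum u j (m + 1) +
      q * Nat.fib j * layeredSum u (j + 1) m) := by
  induction j with
  | zero => intro m h; simp
  | succ j ih =>
    intro m h
    rw [show j + 1 + m + 1 = j + (m + 1) + 1 by ring, ih (m + 1) fun k hk => h k (by omega),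
      layeredSum_add_two, h (2 * j) (by omega), h (2 * j + 1) (by omega),
      Nat.fib_add_two (n := j)]
    push_cast
    ring

lemma weightSum_123_132_213_eq (x q r : A) (n : ℕ) :
    weightSum {p123, p132, p213} (n + 1) (entryWeight x q r) =
      layeredSum (fun k => if k = n then x else if k < n then q else r) 0 (n + 1) := by
  classical
  rw [weightSum_123_132_213, layeredSum]
  unfold weightSum
  refine Finset.sum_congr rfl fun π _ => Finset.prod_congr rfl fun i _ => ?_
  have := i.isLt
  have := (π i).isLt
  simp only [entryWeight]
  split_ifs <;> first | rfl | omega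

/-- The middle position is either a block by itself, with weight `x`, or belongs to a `21` block
with its left or right neighbour, which leaves an extra `q` or `r`. -/
lemma weightSum_123_132_213_odd (x q r : A) (p : ℕ) :
    weightSum {p123, p132, p213} (2 * p + 1) (entryWeight x q r) =
      (q * r) ^ p * (x * Nat.fib (p + 1) ^ 2 + (q + r) * Nat.fib p * Nat.fib (p + 1)) := by
  rw [weightSum_123_132_213_eq, show 2 * p + 1 = p + p + 1 by ring,
    layeredSum_prefix (q := q) p p fun k hk => by
      rw [if_neg (by omega), if_pos (by omega)],
    layeredSum_const (r := r) p (p + 1) fun k hk => by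
      rw [if_neg (by omega), if_neg (by omega)]]
  rcases p with _ | p
  · simp [layeredSum_one]
  · rw [layeredSum_add_two, layeredSum_const (r := r) p (p + 1 + 2) fun k hk => by
      rw [if_neg (by omega), if_neg (by omega)],
      layeredSum_const (r := r) (p + 1) (p + 1 + 1) fun k hk => by
      rw [if_neg (by omega), if_neg (by omega)], if_pos (by omega), if_neg (by omega),
      if_neg (by omega)]
    ring

/-- Either a block boundary falls in the middle, or a `21` block straddles it. The straddling block
lies on the critical antidiagonal and contributes `x ^ 2`. -/
lemma weightSum_123_132_213_even (x q r : A) (p : ℕ) :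
    weightSum {p123, p132, p213} (2 * p + 2) (entryWeight x q r) =
      (q * r) ^ p * (q * r * Nat.fib (p + 2) ^ 2 + x ^ 2 * Nat.fib (p + 1) ^ 2) := by
  rw [weightSum_123_132_213_eq, show 2 * p + 1 + 1 = p + (p + 1) + 1 by ring,
    layeredSum_prefix (q := q) p (p + 1) fun k hk => by
      rw [if_neg (by omega), if_pos (by omega)],
    layeredSum_add_two,
    layeredSum_const (r := r) (p + 1) (p + 1) fun k hk => by
      rw [if_neg (by omega), if_neg (by omega)],
    layeredSum_const (r := r) p (p + 2) fun k hk => by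
      rw [if_neg (by omega), if_neg (by omega)],
    if_neg (by omega), if_pos (by omega), if_pos (by omega), Nat.fib_add_two (n := p)]
  push_cast
  ring

open PowerSeries in
lemma genFun_123_132_213 (x q r : A) :
    genFun {p123, p132, p213} x q r *
        ((1 + C q * C r * X ^ 2) * (1 - 3 * (C q * C r) * X ^ 2 + (C q * C r) ^ 2 * X ^ 4)) =
      1 + C x * X + (C x ^ 2 - C q * C r) * X ^ 2 +
        (-C x * (C q * C r) + C q * (C q * C r) + (C q * C r) * C r) * X ^ 3 -
        C x ^ 2 * (C q * C r) * X ^ 4 := by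
  have hav : AvoidsIff {p123, p132, p213} fun a b c =>
      (a < b ∧ b < c) ∨ (a < c ∧ c < b) ∨ (b < a ∧ a < c) := by
    intro n π
    rw [avoids_triple, not_contains_p123, not_contains_p132, not_contains_p213]
    simp only [not_or, ← forall_and]
  let W : ℕ → A := fun n => weightSum {p123, p132, p213} n (entryWeight x q r)
  have hodd : ∀ p, W (2 * p + 1) = _ := weightSum_123_132_213_odd x q r
  have heven : ∀ p, W (2 * p + 2) = _ := weightSum_123_132_213_even x q r
  have w0 : W 0 = 1 := weightSum_zero hav _
  have w1 : W 1 = x := by simpa using hodd 0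
  have w2 : W 2 = q * r + x ^ 2 := by simpa using heven 0
  have w3 : W 3 = q * r * (x + (q + r)) := by simpa using hodd 1
  have w4 : W 4 = q * r * (4 * (q * r) + x ^ 2) := by
    have := heven 1
    norm_num [Nat.fib_add_two] at this
    rw [this]; ring
  have w5 : W 5 = (q * r) ^ 2 * (4 * x + 2 * (q + r)) := by
    have := hodd 2
    norm_num [Nat.fib_add_two] at this
    rw [this]; ring
  have w6 : W 6 = (q * r) ^ 2 * (9 * (q * r) + 4 * x ^ 2) := by
    have := heven 2
    norm_num [Nat.fib_add_two] at this
    rw [this]; ring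
  -- Squares and products of consecutive Fibonacci numbers satisfy the recurrence with
  -- characteristic polynomial `t ^ 3 - 2 * t ^ 2 - 2 * t + 1 = (t + 1) * (t ^ 2 - 3 * t + 1)`, the
  -- source of the denominator. The closed forms start at length one, so the initial values up to `W
  -- 6` are supplied separately.
  have hrec : ∀ n, W (n + 7) =
      2 * (q * r) * W (n + 5) + 2 * (q * r) ^ 2 * W (n + 3) - (q * r) ^ 3 * W (n + 1) := by
    intro n
    rcases Nat.even_or_odd' n with ⟨p, rfl | rfl⟩
    · rw [show 2 * p + 7 = 2 * (p + 3) + 1 by ring, show 2 * p + 5 = 2 * (p + 2) + 1 by ring,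
        show 2 * p + 3 = 2 * (p + 1) + 1 by ring, hodd, hodd, hodd, hodd]
      simp only [Nat.fib_add_two, show p + 3 + 1 = p + 2 + 2 by ring,
        show p + 3 = p + 1 + 2 by ring, show p + 1 + 1 = p + 2 by ring]
      push_cast
      ring
    · rw [show 2 * p + 1 + 7 = 2 * (p + 3) + 2 by ring,
        show 2 * p + 1 + 5 = 2 * (p + 2) + 2 by ring,
        show 2 * p + 1 + 3 = 2 * (p + 1) + 2 by ring, show 2 * p + 1 + 1 = 2 * p + 2 by ring,
        heven, heven, heven, heven]
      simp only [Nat.fib_add_two, show p + 3 + 1 = p + 2 + 2 by ring,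
        show p + 3 = p + 1 + 2 by ring, show p + 1 + 1 = p + 2 by ring]
      push_cast
      ring
  have h0 := mk_eq_shift W
  have h1 := mk_eq_shift fun n => W (n + 1)
  have h2 := mk_eq_shift fun n => W (n + 2)
  have h3 := mk_eq_shift fun n => W (n + 3)
  have h4 := mk_eq_shift fun n => W (n + 4)
  have h5 := mk_eq_shift fun n => W (n + 5)
  have h6 := mk_eq_shift fun n => W (n + 6)
  have h7 : (PowerSeries.mk fun n => W (n + 7)) =
      2 * (C q * C r) * (PowerSeries.mk fun n => W (n + 5)) +
      2 * (C q * C r) ^ 2 * (PowerSeries.mk fun n => W (n + 3)) -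
      (C q * C r) ^ 3 * (PowerSeries.mk fun n => W (n + 1)) := by
    have c2 : (C (2 : A) : A⟦X⟧) = 2 := map_ofNat C 2
    have e1 : (2 : A⟦X⟧) * (C q * C r) = C (2 * (q * r)) := by simp [c2]
    have e2 : (2 : A⟦X⟧) * (C q * C r) ^ 2 = C (2 * (q * r) ^ 2) := by simp [c2]
    have e3 : ((C q * C r) ^ 3 : A⟦X⟧) = C ((q * r) ^ 3) := by simp
    rw [e1, e2, e3]
    ext n
    simp only [coeff_mk, map_add, map_sub, coeff_C_mul, hrec]
  simp only [add_assoc, Nat.reduceAdd, zero_add, w0, w1, w2, w3, w4, w5, w6, map_one, map_add,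
    map_mul, map_pow, map_ofNat] at h0 h1 h2 h3 h4 h5 h6
  change PowerSeries.mk W * _ = _
  linear_combination
    (1 - 2 * (C q * C r) * X ^ 2 - 2 * (C q * C r) ^ 2 * X ^ 4 + (C q * C r) ^ 3 * X ^ 6) * h0 +
    (1 - 2 * (C q * C r) * X ^ 2 - 2 * (C q * C r) ^ 2 * X ^ 4) * (X * h1 + X ^ 2 * h2) +
    (1 - 2 * (C q * C r) * X ^ 2) * (X ^ 3 * h3 + X ^ 4 * h4) +
    X ^ 5 * h5 + X ^ 6 * h6 + X ^ 7 * h7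

end ReverseLayered
-- Sets containing both `123` and `321`.
section Finite

variable {A : Type*} [CommRing A]

/-- The triple of statistics of a permutation: fixed points, excedances, anti-excedances. -/
def stats {n : ℕ} (π : Equiv.Perm (Fin n)) : ℕ × ℕ × ℕ :=
  (fp π, exc π, (Finset.univ.filter fun i : Fin n => π i < i).card)

/-- The statistics of the permutations of length `n` that avoid `B` at all triples. -/
def avoiderStats (B : ℕ → ℕ → ℕ → Prop) [∀ a b c, Decidable (B a b c)] (n : ℕ) :
    Multiset (ℕ × ℕ × ℕ) :=
  (Finset.univ.filter fun π : Equiv.Perm (Fin n) =>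
    ∀ a b : Fin n, a < b → ∀ c, b < c → ¬ B (π a) (π b) (π c)).val.map stats

lemma weightSum_eq_sum_stats {S : Set Pattern} {B : ℕ → ℕ → ℕ → Prop}
    [∀ a b c, Decidable (B a b c)] (hS : AvoidsIff S B) (n : ℕ) (x q r : A) :
    weightSum S n (entryWeight x q r) =
      ((avoiderStats B n).map fun s => x ^ s.1 * q ^ s.2.1 * r ^ s.2.2).sum := by
  classical
  rw [avoiderStats, Multiset.map_map, weightSum, Finset.sum]
  congr 1
  refine Multiset.map_congr ?_ fun π _ => prod_entryWeight x q r π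
  congr 1
  refine Finset.filter_congr fun π _ => (hS n π).trans ?_
  exact ⟨fun h a b hab c hbc => h a b c hab hbc, fun h a b c hab hbc => h a b hab c hbc⟩

/-- A permutation of length at least five contains `123` or `321`. -/
lemma weightSum_eq_zero {S : Set Pattern} {B : ℕ → ℕ → ℕ → Prop} (hS : AvoidsIff S B)
    (h123 : ∀ a b c, a < b → b < c → B a b c) (h321 : ∀ a b c, c < b → b < a → B a b c)
    {n : ℕ} (hn : 5 ≤ n) (w : ℕ → ℕ → A) : weightSum S n w = 0 := by
  classical
  refine Finset.sum_eq_zero fun π hπ => ?_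
  have hg := isAvoider_valFun hS (Finset.mem_filter.1 hπ).2
  have up : ∀ a b c, a < b → b < c → c < n → ¬ (valFun π a < valFun π b ∧ valFun π b < valFun π c) :=
    fun a b c hab hbc hc h => hg.avoids a b c hab hbc hc (h123 _ _ _ h.1 h.2)
  have down : ∀ a b c, a < b → b < c → c < n →
      ¬ (valFun π c < valFun π b ∧ valFun π b < valFun π a) :=
    fun a b c hab hbc hc h => hg.avoids a b c hab hbc hc (h321 _ _ _ h.1 h.2)
  -- Triples of consecutive positions force the first five entries to alternate. Up to complement
  -- they go up, down, up, down; then positions `0, 1, 3` put entry `3` below entry `1`, and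
  -- positions `1, 3, 4` are decreasing.
  have u1 := up 0 1 2 (by omega) (by omega) (by omega)
  have u2 := up 0 1 3 (by omega) (by omega) (by omega)
  have u3 := up 1 2 3 (by omega) (by omega) (by omega)
  have u4 := up 1 3 4 (by omega) (by omega) (by omega)
  have u5 := up 2 3 4 (by omega) (by omega) (by omega)
  have d1 := down 0 1 2 (by omega) (by omega) (by omega)
  have d2 := down 0 1 3 (by omega) (by omega) (by omega)
  have d3 := down 1 2 3 (by omega) (by omega) (by omega)
  have d4 := down 1 3 4 (by omega) (by omega) (by omega)
  have d5 := down 2 3 4 (by omega) (by omega) (by omega)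
  have n1 := hg.ne 0 1 (by omega) (by omega)
  have n2 := hg.ne 1 2 (by omega) (by omega)
  have n3 := hg.ne 1 3 (by omega) (by omega)
  have n4 := hg.ne 2 3 (by omega) (by omega)
  have n5 := hg.ne 3 4 (by omega) (by omega)
  omega

open PowerSeries in
lemma mk_eq_of_eventually_zero (W : ℕ → A) (h : ∀ n, W (n + 5) = 0) :
    PowerSeries.mk W =
      C (W 0) + C (W 1) * X + C (W 2) * X ^ 2 + C (W 3) * X ^ 3 + C (W 4) * X ^ 4 := by
  have h0 := mk_eq_shift W
  have h1 := mk_eq_shift fun n => W (n + 1)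
  have h2 := mk_eq_shift fun n => W (n + 2)
  have h3 := mk_eq_shift fun n => W (n + 3)
  have h4 := mk_eq_shift fun n => W (n + 4)
  have h5 : (PowerSeries.mk fun n => W (n + 5)) = 0 := by ext n; simp [h]
  simp only [add_assoc, Nat.reduceAdd, zero_add] at h0 h1 h2 h3 h4
  linear_combination h0 + X * h1 + X ^ 2 * h2 + X ^ 3 * h3 + X ^ 4 * h4 + X ^ 5 * h5

open PowerSeries in
lemma genFun_123_132_321 (x q r : A) :
    genFun {p123, p132, p321} x q r =
      1 + C x * X + (C x ^ 2 + C q * C r) * X ^ 2 +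
        (C x * C q * C r + C q ^ 2 * C r + C q * C r ^ 2) * X ^ 3 +
        C q ^ 2 * C r ^ 2 * X ^ 4 := by
  have hav : AvoidsIff {p123, p132, p321} fun a b c =>
      (a < b ∧ b < c) ∨ (a < c ∧ c < b) ∨ (c < b ∧ b < a) := by
    intro n π
    rw [avoids_triple, not_contains_p123, not_contains_p132, not_contains_p321]
    simp only [not_or, ← forall_and]
  rw [genFun, mk_eq_of_eventually_zero _ fun n => weightSum_eq_zero hav
    (fun a b c h h' => Or.inl ⟨h, h'⟩) (fun a b c h h' => Or.inr (Or.inr ⟨h, h'⟩))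
    (Nat.le_add_left 5 n) _]
  simp only [weightSum_eq_sum_stats hav]
  -- Lengths zero to four are enumerated; each triple lists the exponents of `x`, `q`, `r`.
  rw [show avoiderStats _ 0 = {(0, 0, 0)} by decide +kernel,
    show avoiderStats _ 1 = {(1, 0, 0)} by decide +kernel,
    show avoiderStats _ 2 = {(2, 0, 0), (0, 1, 1)} by decide +kernel,
    show avoiderStats _ 3 = {(1, 1, 1), (0, 2, 1), (0, 1, 2)} by decide +kernel,
    show avoiderStats _ 4 = {(0, 2, 2)} by decide +kernel]
  simp
  ring

open PowerSeries in
lemma genFun_123_231_321 (x q r : A) :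
    genFun {p123, p231, p321} x q r =
      1 + C x * X + (C x ^ 2 + C q * C r) * X ^ 2 +
        (2 * C x * C q * C r + C q * C r ^ 2) * X ^ 3 + C q ^ 2 * C r ^ 2 * X ^ 4 := by
  have hav : AvoidsIff {p123, p231, p321} fun a b c =>
      (a < b ∧ b < c) ∨ (c < a ∧ a < b) ∨ (c < b ∧ b < a) := by
    intro n π
    rw [avoids_triple, not_contains_p123, not_contains_p231, not_contains_p321]
    simp only [not_or, ← forall_and]
  rw [genFun, mk_eq_of_eventually_zero _ fun n => weightSum_eq_zero hav
    (fun a b c h h' => Or.inl ⟨h, h'⟩) (fun a b c h h' => Or.inr (Or.inr ⟨h, h'⟩))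
    (Nat.le_add_left 5 n) _]
  simp only [weightSum_eq_sum_stats hav]
  rw [show avoiderStats _ 0 = {(0, 0, 0)} by decide +kernel,
    show avoiderStats _ 1 = {(1, 0, 0)} by decide +kernel,
    show avoiderStats _ 2 = {(2, 0, 0), (0, 1, 1)} by decide +kernel,
    show avoiderStats _ 3 = {(1, 1, 1), (1, 1, 1), (0, 1, 2)} by decide +kernel,
    show avoiderStats _ 4 = {(0, 2, 2)} by decide +kernel]
  simp
  ring

end Finite

/-! ### The twenty three-element sets of patterns of length three. -/

section Classification

/-- The six patterns of length three. -/
def patternThree (i : Fin 6) : Pattern := ![p123, p132, p213, p231, p312, p321] i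

lemma exists_patternThree {p : Pattern} (hp : p.1 = 3) : ∃ i, patternThree i = p := by
  obtain ⟨k, σ⟩ := p
  obtain rfl : k = 3 := hp
  have h : ∀ σ : Equiv.Perm (Fin 3), ∃ i : Fin 6, ∀ j : Fin 3,
      (![![0, 1, 2], ![0, 2, 1], ![1, 0, 2], ![1, 2, 0], ![2, 0, 1], ![2, 1, 0]] :
        Fin 6 → Fin 3 → Fin 3) i j = σ j := by decide +kernel
  obtain ⟨i, hi⟩ := h σ
  refine ⟨i, ?_⟩
  fin_cases i <;> exact congrArg (Sigma.mk 3) (perm_ext_three (hi 0) (hi 1) (hi 2))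

lemma finset_card_eq_three (T : Finset (Fin 6)) (h : T.card = 3) :
    T = {0, 1, 2} ∨ T = {3, 4, 5} ∨ T = {0, 1, 3} ∨ T = {0, 2, 3} ∨ T = {0, 1, 4} ∨
    T = {0, 2, 4} ∨ T = {1, 3, 5} ∨ T = {2, 3, 5} ∨ T = {1, 4, 5} ∨ T = {2, 4, 5} ∨
    T = {1, 2, 3} ∨ T = {1, 2, 4} ∨ T = {1, 3, 4} ∨ T = {2, 3, 4} ∨ T = {0, 3, 4} ∨
    T = {1, 2, 5} ∨ T = {0, 1, 5} ∨ T = {0, 2, 5} ∨ T = {0, 3, 5} ∨ T = {0, 4, 5} := by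
  revert T
  decide +kernel

lemma exists_finset_of_ncard_eq_three {S : Set Pattern} (hS : ∀ p ∈ S, p.1 = 3)
    (h : S.ncard = 3) : ∃ T : Finset (Fin 6), T.card = 3 ∧ patternThree '' (T : Set (Fin 6)) = S := by
  classical
  -- Choosing a set of indices that maps bijectively onto `S` makes it unnecessary to show that the
  -- six patterns are distinct.
  obtain ⟨T, hT, hinj⟩ := Set.SurjOn.exists_bijOn_subset (f := patternThree) (s := Set.univ) (t := S)
    fun p hp => by simpa using exists_patternThree (hS p hp)
  refine ⟨T.toFinset, ?_, by simpa using hinj.image_eq⟩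
  rw [← h, ← hinj.image_eq, hinj.injOn.ncard_image, Set.ncard_eq_toFinset_card']

end Classification
-- Transfer between symmetric sets, and specialization to `F`.
lemma genFun_triple_inv {A : Type*} [CommRing A] (p₁ p₂ p₃ : Pattern) (x q r : A) :
    genFun {p₁.inv, p₂.inv, p₃.inv} x q r = genFun {p₁, p₂, p₃} x r q := by
  have h := genFun_inv {p₁, p₂, p₃} x q r
  rwa [Set.image_insert_eq, Set.image_pair] at h

lemma genFun_triple_revComp {A : Type*} [CommRing A] (p₁ p₂ p₃ : Pattern) (x q r : A) :
    genFun {p₁.revComp, p₂.revComp, p₃.revComp} x q r =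
      genFun {p₁, p₂, p₃} x r q := by
  have h := genFun_revComp {p₁, p₂, p₃} x q r
  rwa [Set.image_insert_eq, Set.image_pair] at h

/-- Each of the two symmetries exchanges `q` and `r`, so the exchanges cancel; this yields the
equalities between pairs of sets in the theorem. -/
lemma genFun_triple_inv_revComp {A : Type*} [CommRing A] (p₁ p₂ p₃ : Pattern) (x q r : A) :
    genFun {p₁.revComp.inv, p₂.revComp.inv, p₃.revComp.inv} x q r =
      genFun {p₁, p₂, p₃} x q r := by
  rw [genFun_triple_inv, genFun_triple_revComp]

lemma F_triple_inv (p₁ p₂ p₃ : Pattern) : F {p₁.inv, p₂.inv, p₃.inv} =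
    genFun {p₁, p₂, p₃} (MvPolynomial.X 0 : Coeffs) 1 (MvPolynomial.X 1) := by
  rw [F_eq_genFun, genFun_triple_inv]

lemma F_triple_revComp (p₁ p₂ p₃ : Pattern) : F {p₁.revComp, p₂.revComp, p₃.revComp} =
    genFun {p₁, p₂, p₃} (MvPolynomial.X 0 : Coeffs) 1 (MvPolynomial.X 1) := by
  rw [F_eq_genFun, genFun_triple_revComp]

lemma F_triple_inv_revComp (p₁ p₂ p₃ : Pattern) :
    F {p₁.revComp.inv, p₂.revComp.inv, p₃.revComp.inv} = F {p₁, p₂, p₃} := by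
  rw [F_eq_genFun, genFun_triple_inv_revComp, F_eq_genFun]

/-- Recognition of a quotient of power series. -/
lemma eq_frac {f a b : Coeffs⟦X⟧} (hb : PowerSeries.constantCoeff b = 1) (h : f * b = a) :
    f = frac a b :=
  (Ring.eq_mul_inverse_iff_mul_eq _ _ _
    (PowerSeries.isUnit_iff_constantCoeff.2 (by rw [hb]; exact isUnit_one))).2 h

lemma constantCoeff_varZ : PowerSeries.constantCoeff varZ = 0 := by simp [varZ]

end PatternAvoidance

theorem mainTheorem10 :
    let x : Coeffs⟦X⟧ := varX
    let q : Coeffs⟦X⟧ := varQ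
    let z : Coeffs⟦X⟧ := varZ
    F {p123, p132, p213} =
      frac (1 + x * z + (x ^ 2 - q) * z ^ 2 + (-x * q + q ^ 2 + q) * z ^ 3 - x ^ 2 * q * z ^ 4)
        ((1 + q * z ^ 2) * (1 - 3 * q * z ^ 2 + q ^ 2 * z ^ 4)) ∧
    F {p231, p312, p321} =
      frac (1)
        (1 - x * z - q * z ^ 2) ∧
    F {p123, p132, p231} =
      frac (1 + x * z + (x ^ 2 - q) * z ^ 2 + q * z ^ 3 + (-x ^ 2 * q + x * q + q ^ 2) * z ^ 4)
        ((1 - q * z ^ 2) ^ 2) ∧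
    F {p123, p213, p231} =
      frac (1 + x * z + (x ^ 2 - q) * z ^ 2 + q * z ^ 3 + (-x ^ 2 * q + x * q + q ^ 2) * z ^ 4)
        ((1 - q * z ^ 2) ^ 2) ∧
    F {p123, p132, p312} =
      frac (1 + x * z + (x ^ 2 - q) * z ^ 2 + q ^ 2 * z ^ 3 + (-x ^ 2 * q + x * q ^ 2 + q ^ 2) * z ^ 4)
        ((1 - q * z ^ 2) ^ 2) ∧
    F {p123, p213, p312} =
      frac (1 + x * z + (x ^ 2 - q) * z ^ 2 + q ^ 2 * z ^ 3 + (-x ^ 2 * q + x * q ^ 2 + q ^ 2) * z ^ 4)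
        ((1 - q * z ^ 2) ^ 2) ∧
    F {p132, p231, p321} =
      frac (1 - z + q * z ^ 2)
        ((1 - z) * (1 - x * z)) ∧
    F {p213, p231, p321} =
      frac (1 - z + q * z ^ 2)
        ((1 - z) * (1 - x * z)) ∧
    F {p132, p312, p321} =
      frac (1 - q * z + q * z ^ 2)
        ((1 - x * z) * (1 - q * z)) ∧
    F {p213, p312, p321} =
      frac (1 - q * z + q * z ^ 2)
        ((1 - x * z) * (1 - q * z)) ∧
    F {p132, p213, p231} =
      frac (1 - z - q * z ^ 2 + 2 * q * z ^ 3 + (-x ^ 2 * q + q ^ 2 - x * q) * z ^ 4 + (x ^ 2 * q - 2 * q ^ 2) * z ^ 5 + x * q ^ 2 * z ^ 6)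
        ((1 - z) * (1 - x * z) * (1 - q * z ^ 2) ^ 2) ∧
    F {p132, p213, p312} =
      frac (1 - q * z - q * z ^ 2 + 2 * q ^ 2 * z ^ 3 + (-x ^ 2 * q - x * q ^ 2 + q ^ 2) * z ^ 4 + (x ^ 2 * q ^ 2 - 2 * q ^ 3) * z ^ 5 + x * q ^ 3 * z ^ 6)
        ((1 - x * z) * (1 - q * z) * (1 - q * z ^ 2) ^ 2) ∧
    F {p132, p231, p312} =
      frac (1 + x * q * z ^ 3)
        ((1 - x * z) * (1 - q * z ^ 2)) ∧
    F {p213, p231, p312} =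
      frac (1 + x * q * z ^ 3)
        ((1 - x * z) * (1 - q * z ^ 2)) ∧
    F {p123, p231, p312} =
      frac (1 + x * z + (x ^ 2 - q) * z ^ 2 + x * q * z ^ 3 + q ^ 2 * z ^ 4)
        ((1 - q * z ^ 2) ^ 2) ∧
    F {p132, p213, p321} =
      frac (1 - (1 + q) * z + 2 * q * z ^ 2 - x * q * z ^ 3)
        ((1 - z) * (1 - x * z) * (1 - q * z)) ∧
    F {p123, p132, p321} =
      1 + x * z + (x ^ 2 + q) * z ^ 2 + (x * q + q ^ 2 + q) * z ^ 3 + q ^ 2 * z ^ 4 ∧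
    F {p123, p213, p321} =
      1 + x * z + (x ^ 2 + q) * z ^ 2 + (x * q + q ^ 2 + q) * z ^ 3 + q ^ 2 * z ^ 4 ∧
    F {p123, p231, p321} =
      1 + x * z + (x ^ 2 + q) * z ^ 2 + (2 * x * q + q) * z ^ 3 + q ^ 2 * z ^ 4 ∧
    F {p123, p312, p321} =
      1 + x * z + (x ^ 2 + q) * z ^ 2 + (2 * x * q + q ^ 2) * z ^ 3 + q ^ 2 * z ^ 4 ∧
    (∀ S : Set Pattern, (∀ p ∈ S, p.1 = 3) → S.ncard = 3 →
      S ∈ ({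
        {p123, p132, p213},
        {p231, p312, p321},
        {p123, p132, p231},
        {p123, p213, p231},
        {p123, p132, p312},
        {p123, p213, p312},
        {p132, p231, p321},
        {p213, p231, p321},
        {p132, p312, p321},
        {p213, p312, p321},
        {p132, p213, p231},
        {p132, p213, p312},
        {p132, p231, p312},
        {p213, p231, p312},
        {p123, p231, p312},
        {p132, p213, p321},
        {p123, p132, p321},
        {p123, p213, p321},
        {p123, p231, p321},
        {p123, p312, p321}} : Set (Set Pattern))) := by
  intro x q z
  have hz : PowerSeries.constantCoeff z = 0 := constantCoeff_varZ
  have h1 : PowerSeries.C (1 : Coeffs) = (1 : Coeffs⟦X⟧) := map_one _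
  have hx : PowerSeries.C (MvPolynomial.X 0 : Coeffs) = x := rfl
  have hq : PowerSeries.C (MvPolynomial.X 1 : Coeffs) = q := rfl
  have hX : (PowerSeries.X : Coeffs⟦X⟧) = z := rfl
  have gx := geom_mul (MvPolynomial.X 0 : Coeffs)
  have gq := geom_mul (MvPolynomial.X 1 : Coeffs)
  have g1 := geom_mul (1 : Coeffs)
  have hD := decSeries_mul (MvPolynomial.X 0 : Coeffs) (MvPolynomial.X 1) 1
  rw [hx, hX] at gx
  rw [hq, hX] at gq
  rw [h1, hX] at g1
  rw [hx, hq, hX, h1] at hD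
  -- These ten equalities reduce ten of the sets to the other ten. When a single symmetry is
  -- applied, the series is evaluated at `q = 1` and `r` equal to the second variable.
  have e123_132_312 : F {p123, p132, p312} =
      genFun {p123, p132, p231} (MvPolynomial.X 0 : Coeffs) 1 (MvPolynomial.X 1) := by
    simpa only [inv_p123, inv_p132, inv_p231] using F_triple_inv p123 p132 p231
  have e123_213_312 : F {p123, p213, p312} =
      genFun {p123, p132, p231} (MvPolynomial.X 0 : Coeffs) 1 (MvPolynomial.X 1) := by
    simpa only [revComp_p123, revComp_p132, revComp_p231] using F_triple_revComp p123 p132 p231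
  have e123_213_231 : F {p123, p213, p231} =
      F {p123, p132, p231} := by
    simpa only [revComp_p123, revComp_p132, revComp_p231, inv_p123, inv_p213, inv_p312] using F_triple_inv_revComp p123 p132 p231
  have e132_312_321 : F {p132, p312, p321} =
      genFun {p132, p231, p321} (MvPolynomial.X 0 : Coeffs) 1 (MvPolynomial.X 1) := by
    simpa only [inv_p132, inv_p231, inv_p321] using F_triple_inv p132 p231 p321
  have e213_312_321 : F {p213, p312, p321} =
      genFun {p132, p231, p321} (MvPolynomial.X 0 : Coeffs) 1 (MvPolynomial.X 1) := by
    simpa only [revComp_p132, revComp_p231, revComp_p321] using F_triple_revComp p132 p231 p321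
  have e213_231_321 : F {p213, p231, p321} =
      F {p132, p231, p321} := by
    simpa only [revComp_p132, revComp_p231, revComp_p321, inv_p213, inv_p312, inv_p321] using F_triple_inv_revComp p132 p231 p321
  have e132_213_312 : F {p132, p213, p312} =
      genFun {p132, p213, p231} (MvPolynomial.X 0 : Coeffs) 1 (MvPolynomial.X 1) := by
    simpa only [inv_p132, inv_p213, inv_p231] using F_triple_inv p132 p213 p231
  have e213_231_312 : F {p213, p231, p312} =
      F {p132, p231, p312} := by
    simpa only [revComp_p132, revComp_p231, revComp_p312, inv_p213, inv_p312, inv_p231] using F_triple_inv_revComp p132 p231 p312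
  have e123_213_321 : F {p123, p213, p321} =
      F {p123, p132, p321} := by
    simpa only [revComp_p123, revComp_p132, revComp_p321, inv_p123, inv_p213, inv_p321] using F_triple_inv_revComp p123 p132 p321
  have e123_312_321 : F {p123, p312, p321} =
      genFun {p123, p231, p321} (MvPolynomial.X 0 : Coeffs) 1 (MvPolynomial.X 1) := by
    simpa only [inv_p123, inv_p231, inv_p321] using F_triple_inv p123 p231 p321
  refine ⟨?_, ?_, ?_, ?_, ?_, ?_, ?_, ?_, ?_, ?_, ?_, ?_, ?_, ?_, ?_, ?_, ?_, ?_, ?_, ?_, ?_⟩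
  · refine eq_frac (by simp [hz]) ?_
    rw [F_eq_genFun]
    have h := genFun_123_132_213 (MvPolynomial.X 0 : Coeffs) (MvPolynomial.X 1) 1
    simp only [hx, hq, hX, h1] at h
    linear_combination h
  · refine eq_frac (by simp [hz]) ?_
    rw [F_eq_genFun]
    have h := genFun_231_312_321 (MvPolynomial.X 0 : Coeffs) (MvPolynomial.X 1) 1
    simp only [hx, hq, hX, h1] at h
    linear_combination h
  · refine eq_frac (by simp [hz]) ?_
    rw [F_eq_genFun]
    have h := genFun_123_132_231 (MvPolynomial.X 0 : Coeffs) (MvPolynomial.X 1) 1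
    simp only [hx, hq, hX, h1] at h
    linear_combination h
  · refine eq_frac (by simp [hz]) ?_
    rw [e123_213_231, F_eq_genFun]
    have h := genFun_123_132_231 (MvPolynomial.X 0 : Coeffs) (MvPolynomial.X 1) 1
    simp only [hx, hq, hX, h1] at h
    linear_combination h
  · refine eq_frac (by simp [hz]) ?_
    rw [e123_132_312]
    have h := genFun_123_132_231 (MvPolynomial.X 0 : Coeffs) 1 (MvPolynomial.X 1)
    simp only [hx, hq, hX, h1] at h
    linear_combination h
  · refine eq_frac (by simp [hz]) ?_
    rw [e123_213_312]
    have h := genFun_123_132_231 (MvPolynomial.X 0 : Coeffs) 1 (MvPolynomial.X 1)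
    simp only [hx, hq, hX, h1] at h
    linear_combination h
  · refine eq_frac (by simp [hz]) ?_
    rw [F_eq_genFun]
    have h := genFun_132_231_321 (MvPolynomial.X 0 : Coeffs) (MvPolynomial.X 1) 1
    simp only [map_mul, hq, hX, h1] at h
    -- Multiplying by the denominator leaves the two geometric series, which `gx` and `g1` cancel
    -- one after the other.
    linear_combination (1 - 1 * z) * (1 - x * z) * h + (1 - 1 * z) * gx +
      q * z ^ 2 * ((1 - x * z) * geom (MvPolynomial.X 0 : Coeffs) * g1 + gx)
  · refine eq_frac (by simp [hz]) ?_
    rw [e213_231_321, F_eq_genFun]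
    have h := genFun_132_231_321 (MvPolynomial.X 0 : Coeffs) (MvPolynomial.X 1) 1
    simp only [map_mul, hq, hX, h1] at h
    linear_combination (1 - 1 * z) * (1 - x * z) * h + (1 - 1 * z) * gx +
      q * z ^ 2 * ((1 - x * z) * geom (MvPolynomial.X 0 : Coeffs) * g1 + gx)
  · refine eq_frac (by simp [hz]) ?_
    rw [e132_312_321]
    have h := genFun_132_231_321 (MvPolynomial.X 0 : Coeffs) 1 (MvPolynomial.X 1)
    simp only [map_mul, hq, hX, h1] at h
    linear_combination (1 - q * z) * (1 - x * z) * h + (1 - q * z) * gx +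
      q * z ^ 2 * ((1 - x * z) * geom (MvPolynomial.X 0 : Coeffs) * gq + gx)
  · refine eq_frac (by simp [hz]) ?_
    rw [e213_312_321]
    have h := genFun_132_231_321 (MvPolynomial.X 0 : Coeffs) 1 (MvPolynomial.X 1)
    simp only [map_mul, hq, hX, h1] at h
    linear_combination (1 - q * z) * (1 - x * z) * h + (1 - q * z) * gx +
      q * z ^ 2 * ((1 - x * z) * geom (MvPolynomial.X 0 : Coeffs) * gq + gx)
  · refine eq_frac (by simp [hz]) ?_
    rw [F_eq_genFun]
    have h := genFun_132_213_231 (MvPolynomial.X 0 : Coeffs) (MvPolynomial.X 1) 1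
    simp only [hx, hq, hX, h1] at h
    linear_combination h
  · refine eq_frac (by simp [hz]) ?_
    rw [e132_213_312]
    have h := genFun_132_213_231 (MvPolynomial.X 0 : Coeffs) 1 (MvPolynomial.X 1)
    simp only [hx, hq, hX, h1] at h
    linear_combination h
  · refine eq_frac (by simp [hz]) ?_
    rw [F_eq_genFun]
    have h := genFun_132_231_312 (MvPolynomial.X 0 : Coeffs) (MvPolynomial.X 1) 1
    linear_combination (1 - x * z) * (1 - q * z ^ 2) * h +
      (decSeries (MvPolynomial.X 0 : Coeffs) (MvPolynomial.X 1) 1 - 1) * (1 - q * z ^ 2) * gx + hD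
  · refine eq_frac (by simp [hz]) ?_
    rw [e213_231_312, F_eq_genFun]
    have h := genFun_132_231_312 (MvPolynomial.X 0 : Coeffs) (MvPolynomial.X 1) 1
    linear_combination (1 - x * z) * (1 - q * z ^ 2) * h +
      (decSeries (MvPolynomial.X 0 : Coeffs) (MvPolynomial.X 1) 1 - 1) * (1 - q * z ^ 2) * gx + hD
  · refine eq_frac (by simp [hz]) ?_
    rw [F_eq_genFun]
    have h := genFun_123_231_312 (MvPolynomial.X 0 : Coeffs) (MvPolynomial.X 1) 1
    linear_combination (1 - q * z ^ 2) ^ 2 * h + (1 - q * z ^ 2) *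
      (decSeries (MvPolynomial.X 0 : Coeffs) (MvPolynomial.X 1) 1 - 1) * hD + (1 + x * z) * hD
  · refine eq_frac (by simp [hz]) ?_
    rw [F_eq_genFun]
    have h := genFun_132_213_321 (MvPolynomial.X 0 : Coeffs) (MvPolynomial.X 1) 1
    simp only [map_mul, hq, hX, h1] at h
    linear_combination (1 - z) * (1 - x * z) * (1 - q * z) * h + (1 - z) * (1 - q * z) * gx +
      q * z ^ 2 * (1 - x * z) * ((1 - q * z) * geom (MvPolynomial.X 1 : Coeffs) * g1 + gq)
  · rw [F_eq_genFun]
    have h := genFun_123_132_321 (MvPolynomial.X 0 : Coeffs) (MvPolynomial.X 1) 1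
    simp only [hx, hq, hX, h1] at h
    linear_combination h
  · rw [e123_213_321, F_eq_genFun]
    have h := genFun_123_132_321 (MvPolynomial.X 0 : Coeffs) (MvPolynomial.X 1) 1
    simp only [hx, hq, hX, h1] at h
    linear_combination h
  · rw [F_eq_genFun]
    have h := genFun_123_231_321 (MvPolynomial.X 0 : Coeffs) (MvPolynomial.X 1) 1
    simp only [hx, hq, hX, h1] at h
    linear_combination h
  · rw [e123_312_321]
    have h := genFun_123_231_321 (MvPolynomial.X 0 : Coeffs) 1 (MvPolynomial.X 1)
    simp only [hx, hq, hX, h1] at h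
    linear_combination h
  · intro S hS hcard
    obtain ⟨T, hT, rfl⟩ := exists_finset_of_ncard_eq_three hS hcard
    rcases finset_card_eq_three T hT with
      rfl | rfl | rfl | rfl | rfl | rfl | rfl | rfl | rfl | rfl |
      rfl | rfl | rfl | rfl | rfl | rfl | rfl | rfl | rfl | rfl
    all_goals
      simp only [Finset.coe_insert, Finset.coe_singleton, Set.image_insert_eq,
        Set.image_singleton, Set.mem_insert_iff, Set.mem_singleton_iff]
      simp [patternThree]
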